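/- For integers $k\ge 1$ and $n\ge 1$, let the book graph $B_n^{(k)}$ be the graph consisting of $n$ copies of the complete graph $K_{k+1}$ sharing a common $K_k$ and otherwise disjoint; that is, it has $k+n$ vertices, of which $k$ form the "spine", and two distinct vertices are adjacent if and only if at least one of them is in the spine. For a finite graph $H$, let the Ramsey number $r(H)$ be the least positive integer $N$ such that every red/blue coloring of the edges of the complete graph $K_N$ contains a monochromatic copy of $H$ as a (not necessarily induced) subgraph. Theorem. For every fixed integer $k\ge 1$, $$r\bigl(B_n^{(k)}\bigr)=2^k n+o_k(n)\qquad (n\to\infty).$$ That is, for every $k \ge 1$ and every $\varepsilon>0$ there is an $n_0=n_0(k,\varepsilon)$ such that $\bigl|\,r(B_n^{(k)})-2^k n\,\bigr|\le \varepsilon n$ for all $n\ge n_0$. -/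

import Mathlib

open Filter Asymptotics

/-- The book graph `B_n^{(k)}`: `n` copies of `K_{k+1}` glued along a common `K_k`. The vertices
`Sum.inl i`, `i : Fin k`, form the spine (the common `K_k`), and each of the `n` vertices
`Sum.inr j` completes the spine to one copy of `K_{k+1}`: two distinct vertices are adjacent
exactly when at least one of them lies in the spine. -/
def bookGraph (k n : ℕ) : SimpleGraph (Fin k ⊕ Fin n) where
  Adj u v := u ≠ v ∧ (u.isLeft = true ∨ v.isLeft = true)
  symm := ⟨fun _ _ h => ⟨h.1.symm, h.2.symm⟩⟩
  loopless := ⟨fun _ h => h.1 rfl⟩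

/-- `RamseyProperty H₁ H₂ N`: every red/blue coloring of the edges of the complete graph `K_N`
(red is `0`, blue is `1`) contains a red copy of `H₁` or a blue copy of `H₂` as a (not necessarily
induced) subgraph. -/
def RamseyProperty {V₁ V₂ : Type*} (H₁ : SimpleGraph V₁) (H₂ : SimpleGraph V₂) (N : ℕ) : Prop :=
  ∀ C : SimpleGraph.TopEdgeLabeling (Fin N) (Fin 2),
    H₁.IsContained (C.labelGraph 0) ∨ H₂.IsContained (C.labelGraph 1)

/-- The Ramsey number `r(H₁, H₂)`: the least `N` such that every red/blue coloring of the edges of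
`K_N` contains a red copy of `H₁` or a blue copy of `H₂`. For finite graphs such an `N` exists by
Ramsey's theorem. (If there were none, the infimum would be `0`.) -/
noncomputable def ramseyNumber {V₁ V₂ : Type*} (H₁ : SimpleGraph V₁) (H₂ : SimpleGraph V₂) : ℕ :=
  sInf {N : ℕ | RamseyProperty H₁ H₂ N}

/-- The diagonal Ramsey number `r(H) = r(H, H)`. -/
noncomputable def diagonalRamseyNumber {V : Type*} (H : SimpleGraph V) : ℕ :=
  ramseyNumber H H

/-!
Colour `K_N` red and blue; the red edges form a graph `G` and the blue ones its complement.

*Lower bound.* Colour at random. Fewer than `n` vertices are expected to be joined in red to a fixed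
`k`-set when `N ≤ (2 ^ k - ε) n`, and the chance of reaching `n` is exponentially small. This is
made precise by counting monochromatic placements of a book with only `s = n / q` pages: one book
with `n` pages creates so many of them (`n (n - 1) ⋯ (n - s + 1)`) that a first moment computation
rules it out (`not_ramseyProperty_bookGraph`, `forall_not_ramseyProperty_bookGraph`).

*Upper bound.* It suffices that every large `G` has, in `G` or in its complement, a `k`-clique with
at least `(2 ^ (-k) - γ) |V|` common neighbours (`exists_hasBook_or_hasBook_compl`).
Take a Szemerédi partition (`exists_regular_partition`). By regularity and Ramsey's theorem inside a
part `i`, it contains `k` large pairwise regular sets, all of whose pairs have density at least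
`1 / 2` in the same colour (`exists_denseRegularTuple_subset`); say that this colour is red for parts
covering at least about half of the vertices. A random transversal red clique of such sets behaves
towards the outside like a tuple of independent random vertices of `i`
(`hasBook_of_denseRegularTuple`), so some red `k`-clique in `i` has about
`∑ j, |j| d(i, j) ^ k` common red neighbours, where `d` is the red density. If this is never enough, then each red part `i` has red density close to `1` to parts of
total size less than `2 ^ (-k) |V|` only. Since `k 2 ^ (-k) ≤ 1 / 2`, a greedy choice gives `k` red
parts `i₁, …, i_k` with pairwise positive blue densities, hence a blue `k`-clique with about
`∑ j, |j| ∏ a, (1 - d(i_a, j))` common blue neighbours. One of these `k + 1` books is large enough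
because of the inequality `∏ a, (1 - x a) + (∑ a, x a ^ k) / k ≥ 2 ^ (1 - k)` on `[0, 1] ^ k`
(`two_mul_half_pow_le_prod_one_sub_add`).
-/

namespace BookRamsey

/-! ### The inequality for the densities -/

/-- `(u ^ k - 1) / k` is nondecreasing in `k`. -/
theorem succ_mul_pow_sub_one_le {u : ℝ} (hu : 0 ≤ u) (k : ℕ) :
    (k + 1) * (u ^ k - 1) ≤ k * (u ^ (k + 1) - 1) := by
  induction k with
  | zero => simp
  | succ k ih =>
    have h : 0 ≤ (u - 1) * (u ^ (k + 1) - 1) := by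
      rcases le_total 1 u with h | h
      · exact mul_nonneg (by linarith) (by linarith [one_le_pow₀ (n := k + 1) h])
      · exact mul_nonneg_of_nonpos_of_nonpos (by linarith)
          (by linarith [pow_le_one₀ (n := k + 1) hu h])
    have h2 := mul_le_mul_of_nonneg_left ih hu
    push_cast
    ring_nf at h h2 ⊢
    linarith

/-- The difference of the two sides vanishes at `u = 1` and is monotone from there up to
`u ≈ 1.84`. The bound `1.7` stays below this and still satisfies `1.7 ^ 4 ≥ 8`, see `two_mul_le_pow`. -/
theorem one_sub_pow_four_le_log {u : ℝ} (hu : 0 ≤ u) (hu' : u ≤ 1.7) :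
    1 - u ^ 4 ≤ 4 * Real.log (2 - u) := by
  have hd : ∀ x : ℝ, x < 2 → HasDerivAt (fun x : ℝ => 4 * Real.log (2 - x) + x ^ 4)
      (4 * (-1 / (2 - x)) + 4 * x ^ 3) x := by
    intro x hx
    have h1 : HasDerivAt (fun x : ℝ => 2 - x) (-1) x := (hasDerivAt_id x).const_sub 2
    have h2 := (h1.log (by linarith)).const_mul 4
    exact (h2.add (hasDerivAt_pow 4 x)).congr_deriv (by norm_num)
  have hfac : ∀ x : ℝ, x < 2 → 4 * (-1 / (2 - x)) + 4 * x ^ 3 =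
      4 * ((x - 1) * (1 + x + x ^ 2 - x ^ 3)) / (2 - x) := by
    intro x hx
    have : (2 - x) ≠ 0 := by linarith
    field_simp
    ring
  have hp : ∀ x : ℝ, 0 ≤ x → x ≤ 1.7 → 0 ≤ 1 + x + x ^ 2 - x ^ 3 := by
    intro x h0 h1
    have : x ^ 2 * (1.7 - x) ≥ 0 := mul_nonneg (sq_nonneg x) (by linarith)
    nlinarith
  have h1 : (fun x : ℝ => 4 * Real.log (2 - x) + x ^ 4) 1 = 1 := by norm_num
  suffices h : (fun x : ℝ => 4 * Real.log (2 - x) + x ^ 4) 1 ≤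
      (fun x : ℝ => 4 * Real.log (2 - x) + x ^ 4) u by
    rw [h1] at h
    simp only at h
    linarith
  rcases le_total u 1 with h | h
  · refine antitoneOn_of_deriv_nonpos (convex_Icc 0 1)
      (fun x hx => (hd x (by linarith [hx.2])).continuousAt.continuousWithinAt)
      (fun x hx => ?_) (fun x hx => ?_) ⟨hu, h⟩ ⟨zero_le_one, le_rfl⟩ h
    · rw [interior_Icc] at hx
      exact (hd x (by linarith [hx.2])).differentiableAt.differentiableWithinAt
    · rw [interior_Icc] at hx
      rw [(hd x (by linarith [hx.2])).deriv, hfac x (by linarith [hx.2])]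
      refine div_nonpos_of_nonpos_of_nonneg ?_ (by linarith [hx.2])
      have := mul_nonneg (sub_nonneg.2 hx.2.le) (hp x hx.1.le (by linarith [hx.2]))
      linarith
  · refine monotoneOn_of_deriv_nonneg (convex_Icc 1 1.7)
      (fun x hx => (hd x (by linarith [hx.2])).continuousAt.continuousWithinAt)
      (fun x hx => ?_) (fun x hx => ?_) ⟨le_rfl, by norm_num⟩ ⟨h, hu'⟩ h
    · rw [interior_Icc] at hx
      exact (hd x (by linarith [hx.2])).differentiableAt.differentiableWithinAt
    · rw [interior_Icc] at hx
      rw [(hd x (by linarith [hx.2])).deriv, hfac x (by linarith [hx.2])]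
      refine div_nonneg ?_ (by linarith [hx.2])
      have := mul_nonneg (sub_nonneg.2 hx.1.le) (hp x (by linarith [hx.1]) (by linarith [hx.2]))
      linarith

theorem one_sub_pow_le_mul_log {k : ℕ} (hk : 4 ≤ k) {u : ℝ} (hu : 0 ≤ u) (hu' : u ≤ 1.7) :
    1 - u ^ k ≤ k * Real.log (2 - u) := by
  induction k, hk using Nat.le_induction with
  | base => exact_mod_cast one_sub_pow_four_le_log hu hu'
  | succ k hk ih =>
    have h := succ_mul_pow_sub_one_le hu k
    have hk0 : (0 : ℝ) < k := by positivity
    have h2 : (k + 1 : ℝ) * (1 - u ^ k) ≤ (k + 1) * (k * Real.log (2 - u)) :=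
      mul_le_mul_of_nonneg_left ih (by positivity)
    refine le_of_mul_le_mul_left ?_ hk0
    push_cast
    linarith

theorem two_mul_le_pow {k : ℕ} (hk : 4 ≤ k) {u : ℝ} (hu : 1.7 ≤ u) : 2 * (k : ℝ) ≤ u ^ k := by
  refine le_trans ?_ (pow_le_pow_left₀ (by norm_num) hu k)
  induction k, hk using Nat.le_induction with
  | base => norm_num
  | succ k hk ih =>
    have : (4 : ℝ) ≤ k := by exact_mod_cast hk
    rw [pow_succ]
    push_cast
    linarith

/-- For `k ≥ 4`, a coordinate `u i ≥ 1.7` alone makes the second summand at least `2`; otherwise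
`∏ i, (2 - u i) ≥ 1 + ∑ i, log (2 - u i)`, and `one_sub_pow_le_mul_log` applies to each term. For
`k ≤ 3` the logarithmic estimate is not available up to the point where a single coordinate
suffices, and the inequality is checked as a polynomial one. -/
theorem two_le_prod_two_sub_add {k : ℕ} (hk : 1 ≤ k) (u : Fin k → ℝ)
    (h0 : ∀ i, 0 ≤ u i) (h2 : ∀ i, u i ≤ 2) :
    2 ≤ ∏ i, (2 - u i) + (∑ i, u i ^ k) / k := by
  rcases Nat.lt_or_ge k 4 with hk4 | hk4
  · interval_cases k
    · simp
    · simp [Fin.prod_univ_two, Fin.sum_univ_two]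
      nlinarith [sq_nonneg (u 0 + u 1 - 2)]
    · simp [Fin.prod_univ_three, Fin.sum_univ_three]
      have a0 := h0 0
      have a1 := h0 1
      have a2 := h0 2
      generalize u 0 = a at *
      generalize u 1 = b at *
      generalize u 2 = c at *
      -- The terms `abc` cancel, and what remains is affine in `ab + bc + ca`.
      have key : (2 - a) * (2 - b) * (2 - c) + (a ^ 3 + b ^ 3 + c ^ 3) / 3 =
        8 - 4 * (a + b + c) + (a + b + c) ^ 3 / 3
          + (a * b + b * c + c * a) * (2 - (a + b + c)) := by ring
      rw [key]
      have he : 0 ≤ a * b + b * c + c * a := by positivity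
      have he' : 3 * (a * b + b * c + c * a) ≤ (a + b + c) ^ 2 := by
        nlinarith [sq_nonneg (a - b), sq_nonneg (b - c), sq_nonneg (c - a)]
      have hs : 0 ≤ a + b + c := by positivity
      generalize a * b + b * c + c * a = e at *
      generalize a + b + c = s at *
      rcases le_total s 2 with h | h
      · nlinarith [mul_nonneg he (sub_nonneg.2 h), mul_nonneg hs (sq_nonneg (s - 2)),
          sq_nonneg (s - 2)]
      · nlinarith [mul_nonneg (sub_nonneg.2 he') (sub_nonneg.2 h), sq_nonneg (s - 3)]
  have hk0 : (0 : ℝ) < k := by positivity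
  by_cases hbig : ∃ i, 1.7 ≤ u i
  · obtain ⟨i, hi⟩ := hbig
    have h3 : u i ^ k ≤ ∑ i, u i ^ k :=
      Finset.single_le_sum (f := fun i => u i ^ k) (fun j _ => pow_nonneg (h0 j) k)
        (Finset.mem_univ i)
    have h4 := two_mul_le_pow hk4 hi
    have h5 : 2 ≤ (∑ i, u i ^ k) / k := by rw [le_div_iff₀ hk0]; linarith
    have h6 : 0 ≤ ∏ i, (2 - u i) := Finset.prod_nonneg fun i _ => by linarith [h2 i]
    linarith
  · push Not at hbig
    have hprod : ∏ i, (2 - u i) = Real.exp (∑ i, Real.log (2 - u i)) := by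
      rw [Real.exp_sum]
      exact Finset.prod_congr rfl fun i _ =>
        (Real.exp_log (by linarith [hbig i])).symm
    have hlog : ∑ i, (1 - u i ^ k) / k ≤ ∑ i, Real.log (2 - u i) := by
      refine Finset.sum_le_sum fun i _ => ?_
      rw [div_le_iff₀ hk0, mul_comm]
      exact one_sub_pow_le_mul_log hk4 (h0 i) (hbig i).le
    have hsum : ∑ i, (1 - u i ^ k) / k = 1 - (∑ i, u i ^ k) / k := by
      rw [← Finset.sum_div, Finset.sum_sub_distrib, sub_div]
      simp [hk0.ne']
    have := Real.add_one_le_exp (∑ i, Real.log (2 - u i))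
    rw [hprod]
    linarith

/-- The inequality balancing red and blue books: for `x` in `[0, 1] ^ k` the sum of `∏ i, (1 - x i)`
and of the mean of the `x i ^ k` is least, with value `2 ^ (1 - k)`, at `x = (1 / 2, …, 1 / 2)`. -/
theorem two_mul_half_pow_le_prod_one_sub_add {k : ℕ} (hk : 1 ≤ k) (x : Fin k → ℝ)
    (h0 : ∀ i, 0 ≤ x i) (h1 : ∀ i, x i ≤ 1) :
    2 * (1 / 2) ^ k ≤ ∏ i, (1 - x i) + (∑ i, x i ^ k) / k := by
  have h := two_le_prod_two_sub_add hk (fun i => 2 * x i) (fun i => by linarith [h0 i])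
    (fun i => by linarith [h1 i])
  have e1 : ∏ i, (2 - 2 * x i) = 2 ^ k * ∏ i, (1 - x i) := by
    simp_rw [show ∀ i, 2 - 2 * x i = 2 * (1 - x i) from fun i => by ring]
    rw [Finset.prod_mul_distrib]
    simp
  simp only [mul_pow] at h
  rw [e1, ← Finset.mul_sum, mul_div_assoc, ← mul_add] at h
  have h2 : (0 : ℝ) < 2 ^ k := by positivity
  refine le_of_mul_le_mul_left ?_ h2
  calc (2 : ℝ) ^ k * (2 * (1 / 2) ^ k) = 2 * (2 * (1 / 2)) ^ k := by rw [mul_pow]; ring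
    _ = 2 := by norm_num
    _ ≤ _ := h

open Finset

universe u

variable {V : Type*}

/-! ### Regular pairs -/

open Classical in
/-- The `0`/`1`-valued real indicator of adjacency. -/
noncomputable def adjInd (G : SimpleGraph V) (x y : V) : ℝ := if G.Adj x y then 1 else 0

/-- The number of pairs in `X × Y` that are edges of `G`, as a real number. -/
noncomputable def edgeCount (G : SimpleGraph V) (X Y : Finset V) : ℝ :=
  ∑ x ∈ X, ∑ y ∈ Y, adjInd G x y

/-- The proportion of pairs in `X × Y` that are edges of `G` (`0` if `X` or `Y` is empty). -/
noncomputable def pairDensity (G : SimpleGraph V) (X Y : Finset V) : ℝ :=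
  edgeCount G X Y / (#X * #Y)

/-- Regularity of the pair `(X, Y)` in the form of a cut-norm bound: on every subpair the number of
edges differs from the one predicted by the density of `(X, Y)` by at most `ε |X| |Y|`. Unlike for
`SimpleGraph.IsUniform`, there is no lower bound on the size of the subpair. -/
def CutRegular (G : SimpleGraph V) (ε : ℝ) (X Y : Finset V) : Prop :=
  ∀ X' ⊆ X, ∀ Y' ⊆ Y, |edgeCount G X' Y' - pairDensity G X Y * (#X' * #Y')| ≤ ε * (#X * #Y)

theorem adjInd_nonneg (G : SimpleGraph V) (x y : V) : 0 ≤ adjInd G x y := by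
  unfold adjInd; split_ifs <;> norm_num

theorem adjInd_le_one (G : SimpleGraph V) (x y : V) : adjInd G x y ≤ 1 := by
  unfold adjInd; split_ifs <;> norm_num

theorem adjInd_compl (G : SimpleGraph V) {x y : V} (h : x ≠ y) :
    adjInd Gᶜ x y = 1 - adjInd G x y := by
  unfold adjInd
  by_cases hG : G.Adj x y <;> simp [hG, h, SimpleGraph.compl_adj]

theorem edgeCount_nonneg (G : SimpleGraph V) (X Y : Finset V) : 0 ≤ edgeCount G X Y :=
  sum_nonneg fun _ _ => sum_nonneg fun _ _ => adjInd_nonneg _ _ _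

theorem edgeCount_le (G : SimpleGraph V) (X Y : Finset V) : edgeCount G X Y ≤ #X * #Y := by
  calc edgeCount G X Y ≤ ∑ x ∈ X, ∑ y ∈ Y, (1 : ℝ) :=
        sum_le_sum fun _ _ => sum_le_sum fun _ _ => adjInd_le_one _ _ _
    _ = #X * #Y := by simp

theorem edgeCount_compl (G : SimpleGraph V) {X Y : Finset V} (h : Disjoint X Y) :
    edgeCount Gᶜ X Y = #X * #Y - edgeCount G X Y := by
  have : edgeCount Gᶜ X Y = ∑ x ∈ X, ∑ y ∈ Y, (1 - adjInd G x y) :=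
    sum_congr rfl fun x hx => sum_congr rfl fun y hy =>
      adjInd_compl G (ne_of_mem_of_not_mem hx (disjoint_right.1 h hy))
  rw [this]
  simp [sum_sub_distrib, edgeCount]

theorem pairDensity_nonneg (G : SimpleGraph V) (X Y : Finset V) : 0 ≤ pairDensity G X Y :=
  div_nonneg (edgeCount_nonneg _ _ _) (by positivity)

theorem pairDensity_le_one (G : SimpleGraph V) (X Y : Finset V) : pairDensity G X Y ≤ 1 :=
  div_le_one_of_le₀ (edgeCount_le _ _ _) (by positivity)

theorem pairDensity_compl (G : SimpleGraph V) {X Y : Finset V} (h : Disjoint X Y)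
    (hX : X.Nonempty) (hY : Y.Nonempty) : pairDensity Gᶜ X Y = 1 - pairDensity G X Y := by
  have h1 : (#X : ℝ) ≠ 0 := by exact_mod_cast hX.card_pos.ne'
  have h2 : (#Y : ℝ) ≠ 0 := by exact_mod_cast hY.card_pos.ne'
  rw [pairDensity, pairDensity, edgeCount_compl G h]
  field_simp

theorem CutRegular.compl {G : SimpleGraph V} {ε : ℝ} {X Y : Finset V} (h : CutRegular G ε X Y)
    (hd : Disjoint X Y) (hX : X.Nonempty) (hY : Y.Nonempty) : CutRegular Gᶜ ε X Y := by
  intro X' hX' Y' hY'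
  rw [edgeCount_compl G (disjoint_of_subset_left hX' (disjoint_of_subset_right hY' hd)),
    pairDensity_compl G hd hX hY, ← abs_neg]
  convert h X' hX' Y' hY' using 2
  ring

theorem CutRegular.mono {G : SimpleGraph V} {ε ε' : ℝ} {X Y : Finset V} (h : CutRegular G ε X Y)
    (hε : ε ≤ ε') : CutRegular G ε' X Y := fun X' hX' Y' hY' =>
  (h X' hX' Y' hY').trans (by gcongr)

open Classical in
theorem edgeCount_eq_card_interedges (G : SimpleGraph V) (X Y : Finset V) :
    edgeCount G X Y = #(G.interedges X Y) := by
  rw [SimpleGraph.interedges_def, card_filter, sum_product]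
  simp [edgeCount, adjInd]

open Classical in
theorem pairDensity_eq_edgeDensity (G : SimpleGraph V) (X Y : Finset V) :
    pairDensity G X Y = (G.edgeDensity X Y : ℝ) := by
  rw [pairDensity, edgeCount_eq_card_interedges, SimpleGraph.edgeDensity_def]
  push_cast
  rfl

open Classical in
theorem _root_.SimpleGraph.IsUniform.cutRegular {G : SimpleGraph V} {ε : ℝ} {X Y : Finset V}
    (h : G.IsUniform ε X Y) : CutRegular G ε X Y := by
  intro X' hX' Y' hY'
  have hε := h.pos
  have cX : (#X' : ℝ) ≤ #X := by exact_mod_cast card_le_card hX'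
  have cY : (#Y' : ℝ) ≤ #Y := by exact_mod_cast card_le_card hY'
  have small : (#X' * #Y' : ℝ) ≤ ε * (#X * #Y) →
      |edgeCount G X' Y' - pairDensity G X Y * (#X' * #Y')| ≤ ε * (#X * #Y) := by
    intro hs
    have h1 := edgeCount_nonneg G X' Y'
    have h2 := edgeCount_le G X' Y'
    have h3 : 0 ≤ pairDensity G X Y * (#X' * #Y') :=
      mul_nonneg (pairDensity_nonneg _ _ _) (by positivity)
    have h4 : pairDensity G X Y * (#X' * #Y') ≤ #X' * #Y' :=
      mul_le_of_le_one_left (by positivity) (pairDensity_le_one _ _ _)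
    rw [abs_le]
    constructor <;> linarith
  by_cases h1 : (#X : ℝ) * ε ≤ #X'
  · by_cases h2 : (#Y : ℝ) * ε ≤ #Y'
    · have h3 := (h hX' hY' h1 h2).le
      rw [← pairDensity_eq_edgeDensity, ← pairDensity_eq_edgeDensity] at h3
      have e : edgeCount G X' Y' = pairDensity G X' Y' * (#X' * #Y') := by
        rcases X'.eq_empty_or_nonempty with rfl | hX
        · simp [edgeCount]
        rcases Y'.eq_empty_or_nonempty with rfl | hY
        · simp [edgeCount]
        have h1 : (#X' : ℝ) ≠ 0 := by exact_mod_cast hX.card_pos.ne'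
        have h2 : (#Y' : ℝ) ≠ 0 := by exact_mod_cast hY.card_pos.ne'
        rw [pairDensity]
        field_simp
      rw [e, ← sub_mul, abs_mul, abs_of_nonneg (show (0 : ℝ) ≤ #X' * #Y' by positivity)]
      gcongr
    · push Not at h2
      apply small
      calc (#X' * #Y' : ℝ) ≤ #X * (#Y * ε) := by gcongr
        _ = _ := by ring
  · push Not at h1
    apply small
    calc (#X' * #Y' : ℝ) ≤ (#X * ε) * #Y := by gcongr
      _ = _ := by ring

/-! ### Counting transversal cliques in regular tuples -/

/-- Resampling one coordinate of a uniformly random element of a product of finite sets does not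
change its distribution. -/
theorem sum_piFinset_update {ι : Type*} [Fintype ι] [DecidableEq ι] (U : ι → Finset V) (a : ι)
    (F : (ι → V) → ℝ) :
    ∑ w ∈ Fintype.piFinset U, ∑ x ∈ U a, F (Function.update w a x) =
      #(U a) * ∑ w ∈ Fintype.piFinset U, F w := by
  rw [← sum_product', mul_sum]
  have : ∀ w ∈ Fintype.piFinset U, (#(U a) : ℝ) * F w = ∑ x ∈ U a, F w := by simp
  rw [sum_congr rfl this, ← sum_product']
  -- The swap `(w, x) ↦ (update w a x, w a)` is an involution.
  refine sum_nbij' (fun p => (Function.update p.1 a p.2, p.1 a))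
    (fun p => (Function.update p.1 a p.2, p.1 a)) ?_ ?_ ?_ ?_ ?_
  · rintro ⟨w, x⟩ h
    simp only [mem_product, Fintype.mem_piFinset] at h ⊢
    refine ⟨fun c => ?_, h.1 a⟩
    by_cases hc : c = a
    · subst hc; simpa using h.2
    · simpa [hc] using h.1 c
  · rintro ⟨w, x⟩ h
    simp only [mem_product, Fintype.mem_piFinset] at h ⊢
    refine ⟨fun c => ?_, h.1 a⟩
    by_cases hc : c = a
    · subst hc; simpa using h.2
    · simpa [hc] using h.1 c
  · simp
  · simp
  · simp

theorem CutRegular.abs_sum_le {G : SimpleGraph V} {ε : ℝ} {X Y X' Y' : Finset V}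
    (h : CutRegular G ε X Y) (hX : X' ⊆ X) (hY : Y' ⊆ Y) (p q : V → Prop)
    [DecidablePred p] [DecidablePred q] :
    |∑ x ∈ X', ∑ y ∈ Y', (adjInd G x y - pairDensity G X Y) *
      ((if p x then 1 else 0) * (if q y then 1 else 0))| ≤ ε * (#X * #Y) := by
  have e : ∑ x ∈ X', ∑ y ∈ Y', (adjInd G x y - pairDensity G X Y) *
      ((if p x then 1 else 0) * (if q y then 1 else 0)) =
      edgeCount G (X'.filter p) (Y'.filter q) -
        pairDensity G X Y * (#(X'.filter p) * #(Y'.filter q)) := by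
    have : edgeCount G (X'.filter p) (Y'.filter q) -
        pairDensity G X Y * (#(X'.filter p) * #(Y'.filter q)) =
        ∑ x ∈ X'.filter p, ∑ y ∈ Y'.filter q, (adjInd G x y - pairDensity G X Y) := by
      simp only [sum_sub_distrib, edgeCount, sum_const, nsmul_eq_mul]
      ring
    rw [this, sum_filter]
    refine sum_congr rfl fun x _ => ?_
    split_ifs with hp
    · rw [sum_filter]
      exact sum_congr rfl fun y _ => by split_ifs <;> simp
    · simp
  rw [e]
  exact h _ ((filter_subset _ _).trans hX) _ ((filter_subset _ _).trans hY)

theorem prod_adjInd {ι : Type*} (G : SimpleGraph V) (S : Finset (ι × ι)) (w : ι → V)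
    [Decidable (∀ e ∈ S, G.Adj (w e.1) (w e.2))] :
    ∏ e ∈ S, adjInd G (w e.1) (w e.2) = if ∀ e ∈ S, G.Adj (w e.1) (w e.2) then 1 else 0 := by
  classical
  simp only [adjInd]
  rw [prod_boole]
  congr

/-- Replacing the indicator of one edge `(a, b)` by the density of the pair changes the number of
transversals with a prescribed set `S` of further edges by at most the regularity error: with all
other coordinates fixed, the remaining constraints split into one on the `a`-th and one on the
`b`-th coordinate. -/
theorem abs_sum_sub_density_mul_prod_le {k : ℕ} {G : SimpleGraph V} {ε : ℝ} (hε : 0 ≤ ε)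
    {U W : Fin k → Finset V} (hU : ∀ c, U c ⊆ W c) {a b : Fin k} (hab : a < b)
    (hreg : CutRegular G ε (W a) (W b)) {S : Finset (Fin k × Fin k)}
    (hS : ∀ e ∈ S, e.1 < e.2) (hnot : (a, b) ∉ S) :
    |∑ w ∈ Fintype.piFinset U, (adjInd G (w a) (w b) - pairDensity G (W a) (W b)) *
      ∏ e ∈ S, adjInd G (w e.1) (w e.2)| ≤ ε * ∏ c, (#(W c) : ℝ) := by
  classical
  obtain ⟨F, hF⟩ : ∃ F : (Fin k → V) → ℝ, F = fun w =>
      (adjInd G (w a) (w b) - pairDensity G (W a) (W b)) *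
        ∏ e ∈ S, adjInd G (w e.1) (w e.2) := ⟨_, rfl⟩
  have hgoal : ∀ w, (adjInd G (w a) (w b) - pairDensity G (W a) (W b)) *
      ∏ e ∈ S, adjInd G (w e.1) (w e.2) = F w := fun w => by rw [hF]
  simp_rw [hgoal]
  clear hgoal
  have hinner : ∀ w, |∑ x ∈ U a, ∑ y ∈ U b,
      F (Function.update (Function.update w a x) b y)| ≤ ε * (#(W a) * #(W b)) := by
    intro w
    set S₁ := S.filter fun e => e.1 ≠ b ∧ e.2 ≠ b
    set S₂ := S.filter fun e => ¬ (e.1 ≠ b ∧ e.2 ≠ b)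
    have hsplit : ∀ x y, F (Function.update (Function.update w a x) b y) =
        (adjInd G x y - pairDensity G (W a) (W b)) *
        ((if ∀ e ∈ S₁, G.Adj (Function.update w a x e.1) (Function.update w a x e.2)
          then 1 else 0) *
         (if ∀ e ∈ S₂, G.Adj (Function.update w b y e.1) (Function.update w b y e.2)
          then 1 else 0)) := by
      intro x y
      rw [← prod_adjInd, ← prod_adjInd, hF]
      simp only [Function.update_self, Function.update_of_ne hab.ne]
      congr 1
      rw [← prod_filter_mul_prod_filter_not S (fun e => e.1 ≠ b ∧ e.2 ≠ b)]
      congr 1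
      · refine prod_congr rfl fun e he => ?_
        have := (mem_filter.1 he).2
        rw [Function.update_of_ne this.1, Function.update_of_ne this.2]
      · refine prod_congr rfl fun e he => ?_
        obtain ⟨heS, he'⟩ := mem_filter.1 he
        have hlt := hS e heS
        have h1 : e.1 ≠ a := by
          intro h
          have : e.2 ≠ b := fun h' => hnot (by rw [← h, ← h']; exact heS)
          exact he' ⟨by rw [h]; exact hab.ne, this⟩
        have h2 : e.2 ≠ a := by
          intro h
          refine he' ⟨?_, by rw [h]; exact hab.ne⟩
          exact ((h ▸ hlt).trans hab).ne
        rw [Function.update_comm hab.ne, Function.update_of_ne h1, Function.update_of_ne h2]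
    simp only [hsplit]
    exact hreg.abs_sum_le (hU a) (hU b) _ _
  have hres : ∑ w ∈ Fintype.piFinset U, ∑ x ∈ U a, ∑ y ∈ U b,
      F (Function.update (Function.update w a x) b y) =
      #(U a) * (#(U b) * ∑ w ∈ Fintype.piFinset U, F w) := by
    rw [← sum_piFinset_update U b F,
      ← sum_piFinset_update U a (fun w => ∑ y ∈ U b, F (Function.update w b y))]
  have hbound : #(U a) * (#(U b) * |∑ w ∈ Fintype.piFinset U, F w|) ≤
      (∏ c, (#(U c) : ℝ)) * (ε * (#(W a) * #(W b))) := by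
    calc #(U a) * (#(U b) * |∑ w ∈ Fintype.piFinset U, F w|)
        = |∑ w ∈ Fintype.piFinset U, ∑ x ∈ U a, ∑ y ∈ U b,
            F (Function.update (Function.update w a x) b y)| := by
          rw [hres, abs_mul, abs_mul, Nat.abs_cast, Nat.abs_cast]
      _ ≤ ∑ w ∈ Fintype.piFinset U, ε * (#(W a) * #(W b)) :=
          (abs_sum_le_sum_abs _ _).trans (sum_le_sum fun w _ => hinner w)
      _ = _ := by simp [Fintype.card_piFinset]
  by_cases h0 : ∃ c, U c = ∅
  · rw [Fintype.piFinset_eq_empty.2 h0]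
    simp only [sum_empty, abs_zero]
    positivity
  push Not at h0
  have ha : (0 : ℝ) < #(U a) := by exact_mod_cast (h0 a).card_pos
  have hb : (0 : ℝ) < #(U b) := by exact_mod_cast (h0 b).card_pos
  have hprod : ∀ f : Fin k → ℝ, ∏ c, f c = f a * (f b * ∏ c ∈ (univ.erase a).erase b, f c) := by
    intro f
    rw [mul_prod_erase _ _ (by simp [hab.ne']), mul_prod_erase _ _ (mem_univ a)]
  have hrest : ∏ c ∈ (univ.erase a).erase b, (#(U c) : ℝ) ≤
      ∏ c ∈ (univ.erase a).erase b, (#(W c) : ℝ) :=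
    prod_le_prod (fun _ _ => by positivity) fun c _ => by exact_mod_cast card_le_card (hU c)
  rw [hprod] at hbound ⊢
  have h3 : (#(U a) * #(U b) : ℝ) * |∑ w ∈ Fintype.piFinset U, F w| ≤ (#(U a) * #(U b)) *
      (ε * (#(W a) * (#(W b) * ∏ c ∈ (univ.erase a).erase b, (#(W c) : ℝ)))) := by
    calc _ ≤ _ := (mul_assoc _ _ _).le.trans hbound
      _ = (#(U a) * #(U b)) * (ε * (#(W a) * #(W b))) *
          ∏ c ∈ (univ.erase a).erase b, (#(U c) : ℝ) := by ring
      _ ≤ (#(U a) * #(U b)) * (ε * (#(W a) * #(W b))) *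
          ∏ c ∈ (univ.erase a).erase b, (#(W c) : ℝ) := by gcongr
      _ = _ := by ring
  exact le_of_mul_le_mul_left h3 (by positivity)

/-- The counting lemma, in subtuples `U` of a tuple `W` of sets: the number of transversals of `U`
spanning the edges in `S` is, up to `|S| ε ∏ |W c|`, what the densities of the pairs in `W`
predict. -/
theorem abs_sum_prod_adjInd_sub_le {k : ℕ} {G : SimpleGraph V} {ε : ℝ} (hε : 0 ≤ ε)
    {U W : Fin k → Finset V} (hU : ∀ c, U c ⊆ W c)
    (hreg : ∀ a b, a < b → CutRegular G ε (W a) (W b)) (S : Finset (Fin k × Fin k))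
    (hS : ∀ e ∈ S, e.1 < e.2) :
    |∑ w ∈ Fintype.piFinset U, ∏ e ∈ S, adjInd G (w e.1) (w e.2) -
      (∏ e ∈ S, pairDensity G (W e.1) (W e.2)) * ∏ c, (#(U c) : ℝ)| ≤
      #S * (ε * ∏ c, (#(W c) : ℝ)) := by
  classical
  induction S using Finset.induction_on with
  | empty => simp [Fintype.card_piFinset]
  | insert e S he ih =>
    have ih := ih fun e' he' => hS e' (mem_insert_of_mem he')
    have hstep := abs_sum_sub_density_mul_prod_le hε hU (hS e (mem_insert_self _ _))
      (hreg _ _ (hS e (mem_insert_self _ _)))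
      (fun e' he' => hS e' (mem_insert_of_mem he')) he
    simp only [prod_insert he, card_insert_of_notMem he, sub_mul, sum_sub_distrib,
      ← mul_sum] at hstep ⊢
    have hd0 := pairDensity_nonneg G (W e.1) (W e.2)
    have hd1 := pairDensity_le_one G (W e.1) (W e.2)
    set d := pairDensity G (W e.1) (W e.2)
    set A := ∑ w ∈ Fintype.piFinset U, ∏ e ∈ S, adjInd G (w e.1) (w e.2)
    set B := ∑ w ∈ Fintype.piFinset U,
      adjInd G (w e.1) (w e.2) * ∏ e ∈ S, adjInd G (w e.1) (w e.2)
    set D := (∏ e ∈ S, pairDensity G (W e.1) (W e.2))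
    calc |B - d * D * ∏ c, (#(U c) : ℝ)|
        = |(B - d * A) + d * (A - D * ∏ c, (#(U c) : ℝ))| := by ring_nf
      _ ≤ |B - d * A| + |d * (A - D * ∏ c, (#(U c) : ℝ))| := abs_add_le _ _
      _ ≤ ε * ∏ c, (#(W c) : ℝ) + 1 * (#S * (ε * ∏ c, (#(W c) : ℝ))) := by
          rw [abs_mul, abs_of_nonneg hd0]
          gcongr
      _ = _ := by push_cast; ring

theorem pairDensity_singleton_mul_card (G : SimpleGraph V) {W : Finset V} (hW : W.Nonempty)
    (v : V) [DecidablePred fun w => G.Adj w v] :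
    pairDensity G W {v} * #W = #(W.filter fun w => G.Adj w v) := by
  have h : (#W : ℝ) ≠ 0 := by exact_mod_cast hW.card_pos.ne'
  rw [pairDensity, edgeCount]
  simp only [sum_singleton, card_singleton, Nat.cast_one, mul_one]
  rw [div_mul_cancel₀ _ h, card_filter]
  push_cast
  exact sum_congr rfl fun x _ => by simp [adjInd]

/-- A regular tuple of sets whose pairs all have density at least `c` contains a transversal clique
with at least as many common neighbours, up to an error `η |V|`, as a tuple of independent random
vertices from these sets has on average. This follows by averaging over all transversal cliques:
by the counting lemma, a proportion `∏ a, d(W a, v)` of them lies in the neighbourhood of `v`. -/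
theorem exists_clique_le_card_commonNeighbors {k : ℕ} [Fintype V] {G : SimpleGraph V}
    [DecidableRel G.Adj]
    {W : Fin k → Finset V} {ε c η : ℝ} (hε : 0 < ε) (hc : 0 < c) (hc1 : c ≤ 1) (hη : η ≤ 1)
    (hcη : 2 * (k ^ 2 * ε) ≤ c ^ (k ^ 2) * η) (hW : ∀ a, (W a).Nonempty)
    (hreg : ∀ a b, a < b → CutRegular G ε (W a) (W b))
    (hdens : ∀ a b, a < b → c ≤ pairDensity G (W a) (W b)) :
    ∃ q : Fin k → V, (∀ a b, a < b → G.Adj (q a) (q b)) ∧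
      ∑ v, ∏ a, pairDensity G (W a) {v} - η * Fintype.card V ≤
        #(univ.filter fun v => ∀ a, G.Adj (q a) v) := by
  classical
  set S : Finset (Fin k × Fin k) := univ.filter fun e => e.1 < e.2 with hSdef
  have hS : ∀ e ∈ S, e.1 < e.2 := fun e he => (mem_filter.1 he).2
  have hScard : #S ≤ k ^ 2 := by
    refine (card_filter_le _ _).trans ?_
    simp [sq]
  set D := ∏ e ∈ S, pairDensity G (W e.1) (W e.2) with hD
  set κ : ℝ := k ^ 2 * ε with hκ
  have hκ0 : 0 ≤ κ := by positivity
  have hDc : c ^ (k ^ 2) ≤ D := by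
    calc c ^ (k ^ 2) ≤ c ^ #S := pow_le_pow_of_le_one hc.le hc1 hScard
      _ = ∏ e ∈ S, c := by simp
      _ ≤ D := prod_le_prod (fun _ _ => hc.le) fun e he => hdens _ _ (hS e he)
  have hck : 0 < c ^ (k ^ 2) := by positivity
  set M := ∏ a, (#(W a) : ℝ) with hM
  have hM0 : 0 < M := prod_pos fun a _ => by exact_mod_cast (hW a).card_pos
  have hcount : ∀ U : Fin k → Finset V, (∀ a, U a ⊆ W a) →
      |∑ w ∈ Fintype.piFinset U, ∏ e ∈ S, adjInd G (w e.1) (w e.2) -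
        D * ∏ c, (#(U c) : ℝ)| ≤ κ * M := by
    intro U hU
    refine (abs_sum_prod_adjInd_sub_le hε.le hU hreg S hS).trans ?_
    rw [hκ, mul_assoc]
    gcongr
    exact_mod_cast hScard
  set g : (Fin k → V) → ℝ := fun w => ∏ e ∈ S, adjInd G (w e.1) (w e.2) with hg
  have hg0 : ∀ w, 0 ≤ g w := fun w => prod_nonneg fun _ _ => adjInd_nonneg _ _ _
  have hgadj : ∀ w, g w ≠ 0 → ∀ a b, a < b → G.Adj (w a) (w b) := by
    intro w hw a b hab
    by_contra hn
    exact hw (prod_eq_zero (i := (a, b)) (by simp [hSdef, hab]) (by simp [adjInd, hn]))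
  set T := ∑ w ∈ Fintype.piFinset W, g w with hT
  have hTM := abs_le.1 (hcount W fun _ => subset_rfl)
  rw [← hM] at hTM
  have hη0 : 0 ≤ η := by
    by_contra hneg
    push Not at hneg
    have := mul_neg_of_pos_of_neg hck hneg
    linarith
  have hDκ : 2 * κ ≤ D * η := hcη.trans (by gcongr)
  have hDpos : 0 < D := hck.trans_le hDc
  have hκD : 2 * κ ≤ D := hDκ.trans (mul_le_of_le_one_right hDpos.le hη)
  have hTpos : 0 < T := by
    have : 0 < (D - κ) * M := mul_pos (by linarith) hM0
    linarith [hTM.1]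
  have hTle : T ≤ (D + κ) * M := by linarith [hTM.2]
  set N : ℝ := (Fintype.card V : ℝ) with hN
  set X := ∑ v, ∏ a, pairDensity G (W a) {v} with hX
  have hXN : X ≤ N := by
    calc X ≤ ∑ v : V, (1 : ℝ) := sum_le_sum fun v _ =>
          prod_le_one (fun _ _ => pairDensity_nonneg _ _ _) fun _ _ => pairDensity_le_one _ _ _
      _ = N := by simp [hN]
  have hN0 : 0 ≤ N := by positivity
  set cn : (Fin k → V) → ℝ := fun w => (#(univ.filter fun v => ∀ a, G.Adj (w a) v) : ℝ) with hcn
  -- Double counting of pairs of a transversal clique and a common neighbour of it.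
  have hsum : M * (D * X - κ * N) ≤ ∑ w ∈ Fintype.piFinset W, g w * cn w := by
    have h1 : ∑ w ∈ Fintype.piFinset W, g w * cn w =
        ∑ v, ∑ w ∈ Fintype.piFinset (fun a => (W a).filter fun x => G.Adj x v), g w := by
      have h2 : ∀ w, g w * cn w = ∑ v, if ∀ a, G.Adj (w a) v then g w else 0 := by
        intro w
        rw [hcn, ← sum_filter, sum_const, nsmul_eq_mul, mul_comm]
      simp_rw [h2]
      rw [sum_comm]
      refine sum_congr rfl fun v _ => ?_
      rw [← sum_filter]
      refine sum_congr ?_ fun _ _ => rfl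
      ext w
      simp [Fintype.mem_piFinset, forall_and]
    rw [h1]
    have h3 : ∀ v, D * (M * ∏ a, pairDensity G (W a) {v}) - κ * M ≤
        ∑ w ∈ Fintype.piFinset (fun a => (W a).filter fun x => G.Adj x v), g w := by
      intro v
      have h4 := (abs_le.1 (hcount (fun a => (W a).filter fun x => G.Adj x v)
        fun a => filter_subset _ _)).1
      have h5 : ∏ a, (#((W a).filter fun x => G.Adj x v) : ℝ) =
          M * ∏ a, pairDensity G (W a) {v} := by
        rw [hM, ← prod_mul_distrib]
        refine prod_congr rfl fun a _ => ?_
        rw [← pairDensity_singleton_mul_card G (hW a) v, mul_comm]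
      rw [h5] at h4
      linarith
    calc M * (D * X - κ * N) = ∑ v, (D * (M * ∏ a, pairDensity G (W a) {v}) - κ * M) := by
          rw [sum_sub_distrib, ← mul_sum, ← mul_sum]
          simp only [sum_const, card_univ, nsmul_eq_mul]
          ring
      _ ≤ _ := sum_le_sum fun v _ => h3 v
  by_contra hcon
  push Not at hcon
  have hlt : ∑ w ∈ Fintype.piFinset W, g w * cn w <
      ∑ w ∈ Fintype.piFinset W, g w * (X - η * N) := by
    refine sum_lt_sum (fun w _ => ?_) ?_
    · rcases (hg0 w).eq_or_lt with h | h
      · simp [← h]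
      · exact mul_le_mul_of_nonneg_left (hcon w (hgadj w h.ne')).le h.le
    · obtain ⟨w, hw, hw'⟩ := exists_ne_zero_of_sum_ne_zero hTpos.ne'
      exact ⟨w, hw, mul_lt_mul_of_pos_left (hcon w (hgadj w hw'))
        ((hg0 w).lt_of_ne' hw')⟩
  rw [← sum_mul, ← hT] at hlt
  have hpos : 0 < X - η * N := by
    have : 0 ≤ ∑ w ∈ Fintype.piFinset W, g w * cn w :=
      sum_nonneg fun w _ => mul_nonneg (hg0 w) (by positivity)
    exact pos_of_mul_pos_right (this.trans_lt hlt) hTpos.le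
  have h6 : T * (X - η * N) ≤ (D + κ) * M * (X - η * N) := by gcongr
  have h7 : (D + κ) * (X - η * N) ≤ D * X - κ * N := by
    have := mul_le_mul_of_nonneg_left hXN hκ0
    have := mul_le_mul_of_nonneg_right hDκ hN0
    have : 0 ≤ κ * (η * N) := by positivity
    linarith
  have h8 := mul_le_mul_of_nonneg_left h7 hM0.le
  linarith

/-! ### Degrees into subsets of the parts of a regular partition -/

theorem edgeCount_eq_sum_right (G : SimpleGraph V) (X Y : Finset V) :
    edgeCount G X Y = ∑ y ∈ Y, edgeCount G X {y} := by
  simp only [edgeCount, sum_singleton]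
  exact sum_comm

/-- In a regular pair `(A, B)`, the vertices of `B` have on average hardly less than the expected
degree into a subset `W` of `A` that is not too small. -/
theorem CutRegular.sum_max_sub_le {G : SimpleGraph V} {ε ζ : ℝ} {A B W : Finset V}
    (h : CutRegular G ε A B) (hε : 0 ≤ ε) (hζ : 0 < ζ) (hWA : W ⊆ A) (hW : W.Nonempty)
    (hζW : ζ * #A ≤ #W) :
    ∑ v ∈ B, max (pairDensity G A B - pairDensity G W {v}) 0 ≤ ε / ζ * #B := by
  classical
  have hw : (0 : ℝ) < #W := by exact_mod_cast hW.card_pos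
  set B' := B.filter fun v => pairDensity G W {v} < pairDensity G A B with hB'
  have h1 : ∑ v ∈ B, max (pairDensity G A B - pairDensity G W {v}) 0 =
      pairDensity G A B * #B' - edgeCount G W B' / #W := by
    have h2 : ∑ v ∈ B, max (pairDensity G A B - pairDensity G W {v}) 0 =
        ∑ v ∈ B', (pairDensity G A B - pairDensity G W {v}) := by
      rw [hB', sum_filter]
      refine sum_congr rfl fun v _ => ?_
      split_ifs with hv
      · exact max_eq_left (by linarith)
      · exact max_eq_right (by linarith)
    rw [h2, sum_sub_distrib, edgeCount_eq_sum_right G W B', sum_div]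
    simp [pairDensity, mul_comm]
  rw [h1]
  have h3 := (abs_le.1 (h W hWA B' (filter_subset _ _))).1
  have h4 : pairDensity G A B * #B' - edgeCount G W B' / #W ≤ ε * (#A * #B) / #W := by
    rw [le_div_iff₀ hw, sub_mul, div_mul_cancel₀ _ hw.ne']
    linarith
  refine h4.trans ?_
  rw [div_le_iff₀ hw]
  calc ε * (#A * #B) = ε / ζ * #B * (ζ * #A) := by field_simp
    _ ≤ ε / ζ * #B * #W := by gcongr

theorem prod_sub_prod_le_sum_max {ι : Type*} (s : Finset ι) (d x : ι → ℝ)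
    (hd0 : ∀ i, 0 ≤ d i) (hd1 : ∀ i, d i ≤ 1) (hx0 : ∀ i, 0 ≤ x i) (hx1 : ∀ i, x i ≤ 1) :
    ∏ i ∈ s, d i - ∏ i ∈ s, x i ≤ ∑ i ∈ s, max (d i - x i) 0 := by
  classical
  induction s using Finset.induction_on with
  | empty => simp
  | insert a s ha ih =>
    rw [prod_insert ha, prod_insert ha, sum_insert ha]
    set p := ∏ i ∈ s, d i
    set q := ∏ i ∈ s, x i
    have hp0 : 0 ≤ p := prod_nonneg fun i _ => hd0 i
    have hp1 : p ≤ 1 := prod_le_one (fun i _ => hd0 i) fun i _ => hd1 i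
    have hm : 0 ≤ max (d a - x a) 0 := le_max_right _ _
    have hs : 0 ≤ ∑ i ∈ s, max (d i - x i) 0 := sum_nonneg fun i _ => le_max_right _ _
    have h1 : (d a - x a) * p ≤ max (d a - x a) 0 :=
      (mul_le_mul_of_nonneg_right (le_max_left _ _) hp0).trans (mul_le_of_le_one_right hm hp1)
    have h2 : x a * (p - q) ≤ ∑ i ∈ s, max (d i - x i) 0 :=
      (mul_le_mul_of_nonneg_left ih (hx0 a)).trans (mul_le_of_le_one_left hs (hx1 a))
    linarith

theorem sum_univ_eq_sum_parts [Fintype V] [DecidableEq V] (P : Finpartition (univ : Finset V))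
    (f : V → ℝ) : ∑ v, f v = ∑ j ∈ P.parts, ∑ v ∈ j, f v := by
  conv_lhs => rw [← P.biUnion_parts]
  exact sum_biUnion P.disjoint

/-- The average number of common neighbours of a tuple of independent random vertices from
`W a ⊆ i a`, where the `i a` are parts of a partition, is controlled by the densities between the
parts: regularity of a pair of parts makes almost all vertices of the second one have the expected
degree into any given large subset of the first one. Only parts of total size `θ |V|` may violate
the lower bound `τ` on the density or be irregular. -/
theorem sum_prod_pairDensity_ge {k : ℕ} [Fintype V] [DecidableEq V]
    (P : Finpartition (univ : Finset V)) {G : SimpleGraph V} {ε ζ θ : ℝ} (hε : 0 ≤ ε) (hζ : 0 < ζ)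
    {i W : Fin k → Finset V} {τ : Fin k → Finset V → ℝ} (hWi : ∀ a, W a ⊆ i a)
    (hW : ∀ a, (W a).Nonempty) (hζW : ∀ a, ζ * #(i a) ≤ #(W a))
    (h0 : ∀ a j, 0 ≤ τ a j) (h1 : ∀ a j, τ a j ≤ 1)
    (bad : Fin k → Finset V → Prop) [∀ a, DecidablePred (bad a)]
    (hgood : ∀ a, ∀ j ∈ P.parts, ¬ bad a j →
      CutRegular G ε (i a) j ∧ τ a j ≤ pairDensity G (i a) j)
    (hbad : ∀ a, ∑ j ∈ P.parts with bad a j, (#j : ℝ) ≤ θ * Fintype.card V) :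
    ∑ j ∈ P.parts, #j * ∏ a, τ a j - k * (ε / ζ + θ) * Fintype.card V ≤
      ∑ v, ∏ a, pairDensity G (W a) {v} := by
  have hcard : ∑ j ∈ P.parts, (#j : ℝ) = Fintype.card V := by
    have := P.sum_card_parts
    rw [card_univ] at this
    exact_mod_cast this
  have hpart : ∀ a, ∀ j ∈ P.parts,
      ∑ v ∈ j, max (τ a j - pairDensity G (W a) {v}) 0 ≤
        ε / ζ * #j + if bad a j then (#j : ℝ) else 0 := by
    intro a j hj
    by_cases hb : bad a j
    · rw [if_pos hb]
      have h2 : ∑ v ∈ j, max (τ a j - pairDensity G (W a) {v}) 0 ≤ ∑ v ∈ j, (1 : ℝ) :=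
        sum_le_sum fun v _ => max_le (by linarith [h1 a j, pairDensity_nonneg G (W a) {v}])
          zero_le_one
      have h3 : 0 ≤ ε / ζ * #j := by positivity
      simp only [sum_const, nsmul_eq_mul, mul_one] at h2
      linarith
    · rw [if_neg hb, add_zero]
      obtain ⟨hr, ht⟩ := hgood a j hj hb
      refine le_trans (sum_le_sum fun v _ => ?_)
        (hr.sum_max_sub_le hε hζ (hWi a) (hW a) (hζW a))
      exact max_le_max (by linarith) le_rfl
  have hmain : ∑ j ∈ P.parts, (#j * ∏ a, τ a j - ∑ v ∈ j, ∏ a, pairDensity G (W a) {v}) ≤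
      ∑ j ∈ P.parts, ∑ a, (ε / ζ * #j + if bad a j then (#j : ℝ) else 0) := by
    refine sum_le_sum fun j hj => ?_
    calc #j * ∏ a, τ a j - ∑ v ∈ j, ∏ a, pairDensity G (W a) {v}
        = ∑ v ∈ j, (∏ a, τ a j - ∏ a, pairDensity G (W a) {v}) := by
          rw [sum_sub_distrib]; simp
      _ ≤ ∑ v ∈ j, ∑ a, max (τ a j - pairDensity G (W a) {v}) 0 :=
          sum_le_sum fun v _ => prod_sub_prod_le_sum_max _ _ _ (fun a => h0 a j)
            (fun a => h1 a j) (fun _ => pairDensity_nonneg _ _ _)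
            fun _ => pairDensity_le_one _ _ _
      _ = ∑ a, ∑ v ∈ j, max (τ a j - pairDensity G (W a) {v}) 0 := sum_comm
      _ ≤ _ := sum_le_sum fun a _ => hpart a j hj
  rw [sum_comm, sum_sub_distrib, ← sum_univ_eq_sum_parts] at hmain
  have hlast : ∑ a, ∑ j ∈ P.parts, (ε / ζ * #j + if bad a j then (#j : ℝ) else 0) ≤
      k * (ε / ζ + θ) * Fintype.card V := by
    calc _ ≤ ∑ a : Fin k, (ε / ζ + θ) * Fintype.card V := by
          refine sum_le_sum fun a _ => ?_
          rw [sum_add_distrib, ← mul_sum, hcard, ← sum_filter, add_mul]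
          gcongr
          exact hbad a
      _ = _ := by simp; ring
  linarith

/-! ### Regular partitions -/

open Classical in
/-- The total size of the members `j` of `T` for which the pair `(i, j)` is of no use: those for
which it is not regular, and `i` itself. -/
noncomputable def irregularWeight (T : Finset (Finset V)) (G : SimpleGraph V) (ε : ℝ)
    (i : Finset V) : ℝ :=
  ∑ j ∈ T with j = i ∨ ¬ CutRegular G ε i j, (#j : ℝ)

theorem irregularWeight_nonneg (T : Finset (Finset V)) (G : SimpleGraph V) (ε : ℝ)
    (i : Finset V) : 0 ≤ irregularWeight T G ε i :=
  sum_nonneg fun _ _ => by positivity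

theorem sum_filter_eq_irregularWeight (T : Finset (Finset V)) (G : SimpleGraph V) (ε : ℝ)
    (i : Finset V) [DecidablePred fun j => j = i ∨ ¬ CutRegular G ε i j] :
    ∑ j ∈ T with j = i ∨ ¬ CutRegular G ε i j, (#j : ℝ) = irregularWeight T G ε i := by
  unfold irregularWeight
  congr

/-- Szemerédi's regularity lemma, with all exceptional sets measured by their total size. -/
theorem exists_regular_partition {ε θ : ℝ} (hε : 0 < ε) (hθ : 0 < θ) :
    ∃ M N₀ : ℕ, 0 < M ∧ ∀ (V : Type u) [Fintype V] [DecidableEq V] (G : SimpleGraph V),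
      N₀ ≤ Fintype.card V → ∃ P : Finpartition (univ : Finset V),
        (∀ j ∈ P.parts, Fintype.card V ≤ M * #j) ∧
        ∑ i ∈ P.parts with θ * Fintype.card V < irregularWeight P.parts G ε i, (#i : ℝ) ≤
          θ * Fintype.card V := by
  classical
  set ε' := min ε (θ ^ 2 / 8) with hε'
  have hε'0 : 0 < ε' := lt_min hε (by positivity)
  set l : ℕ := ⌈8 / θ ^ 2⌉₊ + 1 with hl
  have hl8 : 8 ≤ θ ^ 2 * l := by
    have h1 : 8 / θ ^ 2 ≤ l := by
      rw [hl]; push_cast; exact (Nat.le_ceil _).trans (by linarith)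
    rw [div_le_iff₀ (by positivity)] at h1
    linarith
  refine ⟨2 * SzemerediRegularity.bound ε' l, l,
    Nat.mul_pos two_pos (SzemerediRegularity.bound_pos _ _), ?_⟩
  intro V _ _ G hN
  obtain ⟨P, hPe, hPl, hPb, hPu⟩ := szemeredi_regularity G hε'0 hN
  have hV : 0 < Fintype.card V := by omega
  have hVne : (univ : Finset V).Nonempty := by
    rw [← card_pos, card_univ]; exact hV
  have hp : 0 < #P.parts := by omega
  have hpN : #P.parts ≤ Fintype.card V := by simpa using P.card_parts_le_card
  set N := Fintype.card V with hNdef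
  set p := #P.parts with hpdef
  have hdiv : 1 ≤ N / p := (Nat.one_le_div_iff hp).2 hpN
  have hdivlt : N < p * (N / p + 1) := Nat.lt_mul_div_succ N hp
  have hdivle : p * (N / p) ≤ N := Nat.mul_div_le N p
  have hNR : (0 : ℝ) < N := by exact_mod_cast hV
  have hpR : (0 : ℝ) < p := by exact_mod_cast hp
  refine ⟨P, fun j hj => ?_, ?_⟩
  · have h1 : N / p ≤ #j := by simpa using hPe.average_le_card_part hj
    calc N ≤ p * (N / p + 1) := hdivlt.le
      _ ≤ p * (2 * #j) := Nat.mul_le_mul le_rfl (by omega)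
      _ ≤ SzemerediRegularity.bound ε' l * (2 * #j) := Nat.mul_le_mul hPb le_rfl
      _ = _ := by ring
  have hcard : ∑ j ∈ P.parts, (#j : ℝ) = N := by
    have := P.sum_card_parts
    rw [card_univ] at this
    exact_mod_cast this
  have hsize : ∀ j ∈ P.parts, (#j : ℝ) ≤ θ ^ 2 / 4 * N := by
    intro j hj
    have h1 : #j ≤ N / p + 1 := by simpa using hPe.card_part_le_average_add_one hj
    have h2 : p * #j ≤ 2 * N := by
      calc p * #j ≤ p * (2 * (N / p)) := Nat.mul_le_mul le_rfl (by omega)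
        _ = 2 * (p * (N / p)) := by ring
        _ ≤ 2 * N := by omega
    have h3 : (p : ℝ) * #j ≤ 2 * N := by exact_mod_cast h2
    have h4 : (l : ℝ) ≤ p := by exact_mod_cast hPl
    have h5 : 8 * (#j : ℝ) ≤ θ ^ 2 * (2 * N) := by
      calc 8 * (#j : ℝ) ≤ θ ^ 2 * l * #j := by gcongr
        _ ≤ θ ^ 2 * p * #j := by gcongr
        _ = θ ^ 2 * (p * #j) := by ring
        _ ≤ _ := by gcongr
    linarith
  have hdiag : ∑ i ∈ P.parts, (#i : ℝ) * #i ≤ θ ^ 2 / 4 * N ^ 2 := by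
    calc ∑ i ∈ P.parts, (#i : ℝ) * #i ≤ ∑ i ∈ P.parts, (#i : ℝ) * (θ ^ 2 / 4 * N) :=
          sum_le_sum fun i hi => by gcongr; exact hsize i hi
      _ = θ ^ 2 / 4 * N ^ 2 := by rw [← sum_mul, hcard]; ring
  have hoff : ∑ e ∈ P.nonUniforms G ε', (#e.1 : ℝ) * #e.2 ≤ θ ^ 2 / 2 * N ^ 2 := by
    refine (hPe.sum_nonUniforms_lt' hVne hε'0 hPu).le.trans ?_
    rw [card_univ]
    have h1 : (p : ℝ) ≤ N := by exact_mod_cast hpN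
    calc ε' * ((N : ℝ) + p) ^ 2 ≤ θ ^ 2 / 8 * ((N : ℝ) + N) ^ 2 := by
          gcongr; exact min_le_right _ _
      _ = _ := by ring
  have htotal : ∑ i ∈ P.parts, (#i : ℝ) * irregularWeight P.parts G ε i ≤ θ ^ 2 * N ^ 2 := by
    have h1 : ∑ i ∈ P.parts, (#i : ℝ) * irregularWeight P.parts G ε i ≤
        ∑ i ∈ P.parts, (#i : ℝ) * #i + ∑ e ∈ P.nonUniforms G ε', (#e.1 : ℝ) * #e.2 := by
      have h2 : P.nonUniforms G ε' =
          (P.parts ×ˢ P.parts).filter fun e => e.1 ≠ e.2 ∧ ¬ G.IsUniform ε' e.1 e.2 := by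
        ext ⟨i, j⟩
        simp [Finpartition.mk_mem_nonUniforms, and_assoc]
      rw [h2, sum_filter, sum_product, ← sum_add_distrib]
      refine sum_le_sum fun i hi => ?_
      have h3 : (#i : ℝ) * #i = ∑ j ∈ P.parts, if i = j then (#i : ℝ) * #j else 0 := by
        simp [hi]
      rw [h3, ← sum_add_distrib, irregularWeight, mul_sum, sum_filter]
      refine sum_le_sum fun j hj => ?_
      have hnn : (0 : ℝ) ≤ #i * #j := by positivity
      by_cases hij : i = j
      · subst hij; simp
      · by_cases hr : CutRegular G ε i j
        · simp only [Ne.symm hij, hr, not_true_eq_false, or_self, if_false, hij]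
          split_ifs <;> simp [hnn]
        · have hnu : ¬ G.IsUniform ε' i j := fun hu =>
            hr (hu.cutRegular.mono (min_le_left _ _))
          simp [hij, hr, hnu]
    nlinarith [h1, hdiag, hoff, mul_nonneg (sq_nonneg θ) (sq_nonneg (N : ℝ))]
  have hmarkov : θ * N * ∑ i ∈ P.parts with θ * N < irregularWeight P.parts G ε i, (#i : ℝ) ≤
      ∑ i ∈ P.parts, (#i : ℝ) * irregularWeight P.parts G ε i := by
    rw [mul_sum]
    calc _ ≤ ∑ i ∈ P.parts with θ * N < irregularWeight P.parts G ε i,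
            (#i : ℝ) * irregularWeight P.parts G ε i := by
          refine sum_le_sum fun i hi => ?_
          rw [mul_comm]
          gcongr
          exact (mem_filter.1 hi).2.le
      _ ≤ _ := sum_le_sum_of_subset_of_nonneg (filter_subset _ _) fun i _ _ =>
          mul_nonneg (by positivity) (irregularWeight_nonneg _ _ _ _)
  have hθN : 0 < θ * N := by positivity
  refine le_of_mul_le_mul_left ?_ hθN
  calc _ ≤ _ := hmarkov
    _ ≤ θ ^ 2 * N ^ 2 := htotal
    _ = _ := by ring

/-! ### Weighted Ramsey and Turán arguments -/

section Weighted

variable {α : Type*} {μ : α → ℝ}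

/-- Prepending to a tuple in `S'` an element related to all of `S'`. -/
theorem exists_tuple_cons {S : Finset α} {x : α} (hx : x ∈ S) {a : ℕ} {R : α → α → Prop}
    {S' : Finset α} (hS' : S' ⊆ S) (hR : ∀ y ∈ S', R x y)
    (h : ∃ f : Fin a → α, (∀ i, f i ∈ S') ∧ ∀ i j, i < j → R (f i) (f j)) :
    ∃ f : Fin (a + 1) → α, (∀ i, f i ∈ S) ∧ ∀ i j, i < j → R (f i) (f j) := by
  obtain ⟨f, hf, hfR⟩ := h
  refine ⟨Fin.cons x f, fun i => ?_, fun i j hij => ?_⟩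
  · refine Fin.cases ?_ (fun i => ?_) i
    · simpa using hx
    · simpa using hS' (hf i)
  · induction i using Fin.cases with
    | zero =>
      induction j using Fin.cases with
      | zero => exact absurd hij (lt_irrefl _)
      | succ j => simpa using hR _ (hf j)
    | succ i =>
      induction j using Fin.cases with
      | zero => exact absurd hij (Fin.not_lt_zero _)
      | succ j => simpa using hfR i j (Fin.succ_lt_succ_iff.1 hij)

/-- If every element is unrelated to little weight, then a greedy choice produces a long tuple of
pairwise related elements. -/
theorem exists_tuple_of_sparse_bad (hμ : ∀ x, 0 ≤ μ x) (bad : α → α → Prop)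
    [∀ x, DecidablePred (bad x)] {t : ℝ} (ht : 0 ≤ t) (k : ℕ) (S : Finset α)
    (hS : ∀ x ∈ S, ∑ y ∈ S with bad x y, μ y ≤ t) (hk : k * t < ∑ x ∈ S, μ x + t) :
    ∃ f : Fin k → α, (∀ i, f i ∈ S) ∧ ∀ i j, i < j → ¬ bad (f i) (f j) := by
  induction k generalizing S with
  | zero => exact ⟨Fin.elim0, fun i => i.elim0, fun i => i.elim0⟩
  | succ k ih =>
    push_cast at hk
    have hk0 : 0 ≤ (k : ℝ) * t := by positivity
    obtain ⟨x, hx, -⟩ := exists_ne_zero_of_sum_ne_zero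
      (show ∑ x ∈ S, μ x ≠ 0 by intro h; linarith)
    have hsplit := sum_filter_add_sum_filter_not S (bad x) μ
    have hx' := hS x hx
    refine exists_tuple_cons (R := fun x y => ¬ bad x y) hx (filter_subset (fun y => ¬ bad x y) S)
      (fun y hy => (mem_filter.1 hy).2)
      (ih (S.filter fun y => ¬ bad x y) (fun z hz => ?_) ?_)
    · exact (sum_le_sum_of_subset_of_nonneg (filter_subset_filter _ (filter_subset _ _))
        fun _ _ _ => hμ _).trans (hS z (filter_subset _ _ hz))
    · linarith

/-- Ramsey's theorem for two colours `R` and `B` where every element has few uncoloured pairs. -/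
theorem exists_monochromatic_tuple (hμ : ∀ x, 0 ≤ μ x) (bad R B : α → α → Prop)
    [∀ x, DecidablePred (bad x)] {t : ℝ} (ht : 0 < t) (n : ℕ) :
    ∀ a b, a + b = n → ∀ S : Finset α,
      (∀ x ∈ S, ∀ y ∈ S, bad x y ∨ R x y ∨ B x y) →
      (∀ x ∈ S, ∑ y ∈ S with bad x y, μ y ≤ t) → 3 ^ n * t ≤ ∑ x ∈ S, μ x →
      (∃ f : Fin a → α, (∀ i, f i ∈ S) ∧ ∀ i j, i < j → R (f i) (f j)) ∨
      (∃ f : Fin b → α, (∀ i, f i ∈ S) ∧ ∀ i j, i < j → B (f i) (f j)) := by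
  classical
  induction n with
  | zero =>
    intro a b hab S _ _ _
    obtain rfl : a = 0 := by omega
    exact Or.inl ⟨Fin.elim0, fun i => i.elim0, fun i => i.elim0⟩
  | succ n ih =>
    intro a b hab S hcol hS hw
    rcases Nat.eq_zero_or_pos a with rfl | ha
    · exact Or.inl ⟨Fin.elim0, fun i => i.elim0, fun i => i.elim0⟩
    rcases Nat.eq_zero_or_pos b with rfl | hb
    · exact Or.inr ⟨Fin.elim0, fun i => i.elim0, fun i => i.elim0⟩
    obtain ⟨a, rfl⟩ := Nat.exists_eq_succ_of_ne_zero ha.ne'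
    obtain ⟨b, rfl⟩ := Nat.exists_eq_succ_of_ne_zero hb.ne'
    simp only [Nat.succ_eq_add_one] at hab ⊢
    have h3 : (1 : ℝ) ≤ 3 ^ n := one_le_pow₀ (by norm_num)
    have h3t : t ≤ 3 ^ n * t := le_mul_of_one_le_left ht.le h3
    rw [pow_succ] at hw
    obtain ⟨x, hx, -⟩ := exists_ne_zero_of_sum_ne_zero
      (show ∑ x ∈ S, μ x ≠ 0 by intro h; linarith)
    have hsplit := sum_filter_add_sum_filter_not S (bad x) μ
    have hsplit' := sum_filter_add_sum_filter_not (S.filter fun y => ¬ bad x y) (R x) μ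
    have hx' := hS x hx
    set S₁ := (S.filter fun y => ¬ bad x y).filter (R x)
    set S₂ := (S.filter fun y => ¬ bad x y).filter fun y => ¬ R x y
    have hS₁ : S₁ ⊆ S := (filter_subset _ _).trans (filter_subset _ _)
    have hS₂ : S₂ ⊆ S := (filter_subset _ _).trans (filter_subset _ _)
    have hR : ∀ y ∈ S₁, R x y := fun y hy => (mem_filter.1 hy).2
    have hB : ∀ y ∈ S₂, B x y := by
      intro y hy
      obtain ⟨hy1, hy2⟩ := mem_filter.1 hy
      obtain ⟨hyS, hy3⟩ := mem_filter.1 hy1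
      rcases hcol x hx y hyS with h | h | h
      exacts [absurd h hy3, absurd h hy2, h]
    have hbad : ∀ S' ⊆ S, ∀ x ∈ S', ∑ y ∈ S' with bad x y, μ y ≤ t := fun S' hS' z hz =>
      (sum_le_sum_of_subset_of_nonneg (filter_subset_filter _ hS')
        fun _ _ _ => hμ _).trans (hS z (hS' hz))
    rcases le_total (3 ^ n * t) (∑ y ∈ S₁, μ y) with h | h
    · rcases ih a (b + 1) (by omega) S₁ (fun x hx y hy => hcol x (hS₁ hx) y (hS₁ hy))
        (hbad S₁ hS₁) h with h | ⟨f, hf, hf'⟩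
      · exact Or.inl (exists_tuple_cons hx hS₁ hR h)
      · exact Or.inr ⟨f, fun i => hS₁ (hf i), hf'⟩
    · rcases ih (a + 1) b (by omega) S₂ (fun x hx y hy => hcol x (hS₂ hx) y (hS₂ hy))
        (hbad S₂ hS₂) (by linarith) with ⟨f, hf, hf'⟩ | h
      · exact Or.inl ⟨f, fun i => hS₂ (hf i), hf'⟩
      · exact Or.inr (exists_tuple_cons hx hS₂ hB h)

end Weighted

/-! ### Regular tuples inside a set of vertices -/

/-- All pairs of the tuple `W` are `ε`-regular of density at least `c`. -/
def DenseRegularTuple {k : ℕ} (G : SimpleGraph V) (ε c : ℝ) (W : Fin k → Finset V) : Prop :=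
  ∀ a b, a < b → CutRegular G ε (W a) (W b) ∧ c ≤ pairDensity G (W a) (W b)

/-- In a large graph or in its complement one finds a `k`-tuple of sets of linear size which are
pairwise regular with density at least `1 / 2`. -/
theorem exists_denseRegularTuple (k : ℕ) {ε : ℝ} (hε : 0 < ε) :
    ∃ ζ : ℝ, 0 < ζ ∧ ∃ L : ℕ, ∀ (V : Type u) [Fintype V] (G : SimpleGraph V),
      L ≤ Fintype.card V → ∃ W : Fin k → Finset V, (∀ a, ζ * Fintype.card V ≤ #(W a)) ∧
        (DenseRegularTuple G ε (1 / 2) W ∨ DenseRegularTuple Gᶜ ε (1 / 2) W) := by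
  classical
  obtain ⟨θ, hθ0, hθ1⟩ : ∃ θ : ℝ, 0 < θ ∧ 3 ^ (k + k) * θ = 1 - θ :=
    ⟨1 / (3 ^ (k + k) + 1), by positivity, by field_simp; ring⟩
  obtain ⟨M, N₀, hM, hreg⟩ := exists_regular_partition.{u} hε hθ0
  have hMR : (0 : ℝ) < M := by exact_mod_cast hM
  refine ⟨1 / M, by positivity, N₀ + 1, fun V _ G hN => ?_⟩
  obtain ⟨P, hPM, hPw⟩ := hreg V G (by omega)
  have hNR : (0 : ℝ) < Fintype.card V := by exact_mod_cast (by omega : 0 < Fintype.card V)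
  have hcard : ∑ j ∈ P.parts, (#j : ℝ) = Fintype.card V := by
    have := P.sum_card_parts
    rw [card_univ] at this
    exact_mod_cast this
  set S := P.parts.filter fun i => ¬ θ * Fintype.card V < irregularWeight P.parts G ε i with hS
  have hSP : S ⊆ P.parts := filter_subset _ _
  have hSw := sum_filter_add_sum_filter_not P.parts
    (fun i => θ * Fintype.card V < irregularWeight P.parts G ε i) fun i => (#i : ℝ)
  have hsize : ∀ j ∈ S, 1 / (M : ℝ) * Fintype.card V ≤ #j := by
    intro j hj
    have : (Fintype.card V : ℝ) ≤ M * #j := by exact_mod_cast hPM j (hSP hj)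
    rw [one_div, inv_mul_le_iff₀ hMR]
    exact this
  have key := exists_monochromatic_tuple (μ := fun j : Finset V => (#j : ℝ))
    (fun _ => by positivity) (fun i j => j = i ∨ ¬ CutRegular G ε i j)
    (fun i j => CutRegular G ε i j ∧ 1 / 2 ≤ pairDensity G i j)
    (fun i j => CutRegular Gᶜ ε i j ∧ 1 / 2 ≤ pairDensity Gᶜ i j)
    (t := θ * Fintype.card V) (mul_pos hθ0 hNR) (k + k) k k rfl S ?_ ?_ ?_
  · rcases key with ⟨W, hW, hW'⟩ | ⟨W, hW, hW'⟩
    · exact ⟨W, fun a => hsize _ (hW a), Or.inl hW'⟩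
    · exact ⟨W, fun a => hsize _ (hW a), Or.inr hW'⟩
  · intro i hi j hj
    by_cases hb : j = i ∨ ¬ CutRegular G ε i j
    · exact Or.inl hb
    · push Not at hb
      obtain ⟨hij, hr⟩ := hb
      have hd : Disjoint i j := P.disjoint (hSP hi) (hSP hj) (Ne.symm hij)
      have hi' := P.nonempty_of_mem_parts (hSP hi)
      have hj' := P.nonempty_of_mem_parts (hSP hj)
      refine Or.inr ?_
      rcases le_total (1 / 2) (pairDensity G i j) with h | h
      · exact Or.inl ⟨hr, h⟩
      · refine Or.inr ⟨hr.compl hd hi' hj', ?_⟩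
        rw [pairDensity_compl G hd hi' hj']
        linarith
  · intro i hi
    refine le_trans (sum_le_sum_of_subset_of_nonneg (filter_subset_filter _ hSP)
      fun _ _ _ => by positivity) (not_lt.1 (mem_filter.1 hi).2)
  · rw [← mul_assoc, hθ1]
    linarith

theorem edgeCount_map {V' : Type*} (e : V' ↪ V) (G : SimpleGraph V) (X Y : Finset V') :
    edgeCount G (X.map e) (Y.map e) = edgeCount (G.comap e) X Y := by
  simp only [edgeCount, sum_map]
  rfl

theorem pairDensity_map {V' : Type*} (e : V' ↪ V) (G : SimpleGraph V) (X Y : Finset V') :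
    pairDensity G (X.map e) (Y.map e) = pairDensity (G.comap e) X Y := by
  simp [pairDensity, edgeCount_map]

theorem CutRegular.map {V' : Type*} (e : V' ↪ V) {G : SimpleGraph V} {ε : ℝ} {X Y : Finset V'}
    (h : CutRegular (G.comap e) ε X Y) : CutRegular G ε (X.map e) (Y.map e) := by
  intro X' hX' Y' hY'
  obtain ⟨X'', hX'', rfl⟩ := subset_map_iff.1 hX'
  obtain ⟨Y'', hY'', rfl⟩ := subset_map_iff.1 hY'
  simpa [edgeCount_map, pairDensity_map] using h X'' hX'' Y'' hY''

theorem DenseRegularTuple.map {V' : Type*} (e : V' ↪ V) {G : SimpleGraph V} {ε c : ℝ} {k : ℕ}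
    {W : Fin k → Finset V'} (h : DenseRegularTuple (G.comap e) ε c W) :
    DenseRegularTuple G ε c fun a => (W a).map e := fun a b hab =>
  ⟨(h a b hab).1.map e, by rw [pairDensity_map]; exact (h a b hab).2⟩

/-- `exists_denseRegularTuple` for the graph induced on a large set `A` of vertices. -/
theorem exists_denseRegularTuple_subset (k : ℕ) {ε : ℝ} (hε : 0 < ε) :
    ∃ ζ : ℝ, 0 < ζ ∧ ∃ L : ℕ, ∀ (V : Type u) (G : SimpleGraph V) (A : Finset V),
      L ≤ #A → ∃ W : Fin k → Finset V, (∀ a, W a ⊆ A) ∧ (∀ a, ζ * #A ≤ #(W a)) ∧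
        (DenseRegularTuple G ε (1 / 2) W ∨ DenseRegularTuple Gᶜ ε (1 / 2) W) := by
  obtain ⟨ζ, hζ, L, h⟩ := exists_denseRegularTuple.{u} k hε
  refine ⟨ζ, hζ, L, fun V G A hA => ?_⟩
  set e : {x // x ∈ A} ↪ V := Function.Embedding.subtype _
  obtain ⟨W, hW, hW'⟩ := h {x // x ∈ A} (G.comap e) (by simpa using hA)
  have hc : (G.comap e)ᶜ = Gᶜ.comap e := by
    ext x y
    simp [SimpleGraph.compl_adj]
  rw [hc] at hW'
  refine ⟨fun a => (W a).map e, fun a x hx => ?_, fun a => ?_, ?_⟩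
  · obtain ⟨y, -, rfl⟩ := mem_map.1 hx
    exact y.2
  · simpa using hW a
  · exact hW'.imp (fun h => h.map e) fun h => h.map e

/-! ### Books in a graph or its complement -/

open Classical in
/-- `G` contains a clique with `k` vertices, indexed by `Fin k`, having at least `x` common
neighbours. These lie outside the clique, as no vertex is adjacent to itself. -/
def HasBook [Fintype V] (k : ℕ) (G : SimpleGraph V) (x : ℝ) : Prop :=
  ∃ q : Fin k → V, (∀ a b, a < b → G.Adj (q a) (q b)) ∧
    x ≤ #(univ.filter fun v => ∀ a, G.Adj (q a) v)

theorem HasBook.mono [Fintype V] {k : ℕ} {G : SimpleGraph V} {x y : ℝ} (h : HasBook k G x)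
    (hxy : y ≤ x) : HasBook k G y :=
  let ⟨q, hq, hx⟩ := h
  ⟨q, hq, hxy.trans hx⟩

/-- A tuple of large, pairwise dense and regular subsets of parts of a regular partition yields a
book with about as many pages as the densities between the parts predict. Here `τ a j` is a lower
bound for the density of `(i a, j)`, valid for all `j` outside a small collection of bad parts. -/
theorem hasBook_of_denseRegularTuple {k : ℕ} [Fintype V] [DecidableEq V]
    (P : Finpartition (univ : Finset V)) {G : SimpleGraph V} {ε ε' ζ θ c η : ℝ}
    (hε' : 0 < ε') (hc : 0 < c) (hc1 : c ≤ 1) (hη : η ≤ 1)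
    (hcη : 2 * (k ^ 2 * ε') ≤ c ^ (k ^ 2) * η) (hε : 0 ≤ ε) (hζ : 0 < ζ)
    {i W : Fin k → Finset V} {τ : Fin k → Finset V → ℝ} (hi : ∀ a, i a ∈ P.parts)
    (hWi : ∀ a, W a ⊆ i a) (hζW : ∀ a, ζ * #(i a) ≤ #(W a)) (hW : DenseRegularTuple G ε' c W)
    (h0 : ∀ a j, 0 ≤ τ a j) (h1 : ∀ a j, τ a j ≤ 1)
    (bad : Fin k → Finset V → Prop) [∀ a, DecidablePred (bad a)]
    (hgood : ∀ a, ∀ j ∈ P.parts, ¬ bad a j →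
      CutRegular G ε (i a) j ∧ τ a j ≤ pairDensity G (i a) j)
    (hbad : ∀ a, ∑ j ∈ P.parts with bad a j, (#j : ℝ) ≤ θ * Fintype.card V) :
    HasBook k G (∑ j ∈ P.parts, #j * ∏ a, τ a j -
      (η + k * (ε / ζ + θ)) * Fintype.card V) := by
  classical
  have hne : ∀ a, (W a).Nonempty := by
    intro a
    have h2 : (0 : ℝ) < #(i a) := by exact_mod_cast (P.nonempty_of_mem_parts (hi a)).card_pos
    have h3 : (0 : ℝ) < #(W a) := (mul_pos hζ h2).trans_le (hζW a)
    exact card_pos.1 (by exact_mod_cast h3)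
  obtain ⟨q, hq, hq'⟩ := exists_clique_le_card_commonNeighbors hε' hc hc1 hη hcη hne
    (fun a b hab => (hW a b hab).1) (fun a b hab => (hW a b hab).2)
  refine ⟨q, hq, ?_⟩
  have h4 := sum_prod_pairDensity_ge P hε hζ hWi hne hζW h0 h1 bad hgood hbad
  have h5 : (∑ j ∈ P.parts, #j * ∏ a, τ a j - (η + k * (ε / ζ + θ)) * Fintype.card V) ≤
      ∑ v, ∏ a, pairDensity G (W a) {v} - η * Fintype.card V := by linarith
  refine h5.trans ?_
  convert hq'

theorem nat_mul_half_pow_le (k : ℕ) : (k : ℝ) * (1 / 2) ^ k ≤ 1 / 2 := by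
  have : (2 * k : ℝ) ≤ 2 ^ k := by
    have h : ∀ n : ℕ, 2 * n ≤ 2 ^ n := by
      intro n
      rcases n with _ | n
      · simp
      · have := Nat.lt_two_pow_self (n := n)
        rw [pow_succ]; omega
    exact_mod_cast h k
  rw [one_div_pow, mul_one_div, div_le_iff₀ (by positivity)]
  linarith

/-- The case of the main estimate in which parts of about half of the total size contain dense
regular tuples of the graph `G` itself. -/
theorem hasBook_or_hasBook_compl_of_parts {k : ℕ} (hk : 1 ≤ k) [Fintype V] [DecidableEq V]
    [Nonempty V] (P : Finpartition (univ : Finset V)) {G : SimpleGraph V}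
    {γ ε₁ ε₂ ζ θ δ : ℝ} (hγ : 0 < γ) (hγ1 : γ ≤ 1)
    (hε₂ : 0 < ε₂) (hε₂' : 2 * (k ^ 2 * ε₂) ≤ (1 / 2) ^ (k ^ 2) * (γ / 4))
    (hζ : 0 < ζ) (hζ1 : ζ ≤ 1) (hδ : 0 < δ) (hδ' : k * δ = γ / 2)
    (hθ : 0 < θ) (hθ' : k * θ ≤ γ / 8) (hθ'' : k * θ < (1 / 2) ^ k)
    (hε₁ : 0 < ε₁) (hε₁' : 2 * (k ^ 2 * ε₁) ≤ δ ^ (k ^ 2) * (γ / 4))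
    (hε₁'' : k * (ε₁ / ζ) ≤ γ / 8)
    {R : Finset (Finset V)} (hR : R ⊆ P.parts)
    (hRw : ∀ i ∈ R, irregularWeight P.parts G ε₁ i ≤ θ * Fintype.card V)
    (hRsum : Fintype.card V / 2 - θ * Fintype.card V ≤ ∑ i ∈ R, (#i : ℝ))
    (hW : ∀ i ∈ R, ∃ W : Fin k → Finset V, (∀ a, W a ⊆ i) ∧ (∀ a, ζ * #i ≤ #(W a)) ∧
      DenseRegularTuple G ε₂ (1 / 2) W) :
    HasBook k G (((1 / 2) ^ k - γ) * Fintype.card V) ∨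
      HasBook k Gᶜ (((1 / 2) ^ k - γ) * Fintype.card V) := by
  classical
  by_contra hcon
  push Not at hcon
  obtain ⟨hred, hblue⟩ := hcon
  set N : ℝ := (Fintype.card V : ℝ) with hN
  have hN0 : 0 < N := by rw [hN]; exact_mod_cast Fintype.card_pos
  have hk1 : (1 : ℝ) ≤ k := by exact_mod_cast hk
  have hk0 : (0 : ℝ) < k := by linarith
  have hδ1 : δ ≤ 1 := by nlinarith
  set h : ℝ := (1 / 2) ^ k with hh
  have hh0 : 0 < h := by positivity
  have hh1 : h ≤ 1 := pow_le_one₀ (by norm_num) (by norm_num)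
  have hcard : ∑ j ∈ P.parts, (#j : ℝ) = N := by
    have := P.sum_card_parts
    rw [card_univ] at this
    rw [hN]
    exact_mod_cast this
  have herr : γ / 4 + k * (ε₁ / ζ + θ) ≤ γ / 2 := by linarith
  have herr1 : γ / 4 + k * (ε₁ / 1 + θ) ≤ γ / 2 := by
    have : ε₁ / 1 ≤ ε₁ / ζ := by gcongr
    have := mul_le_mul_of_nonneg_left this hk0.le
    linarith
  -- Every part in `R` has small densities to the others in the `k`-th power mean.
  have hpow : ∀ i ∈ R, ∑ j ∈ P.parts, #j * pairDensity G i j ^ k < (h - γ / 2) * N := by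
    intro i hi
    obtain ⟨W, hWi, hζW, hWd⟩ := hW i hi
    by_contra hge
    push Not at hge
    refine hred ((hasBook_of_denseRegularTuple P (θ := θ) (i := fun _ => i)
      (τ := fun _ j => pairDensity G i j) hε₂ (by norm_num) (by norm_num) (by linarith) hε₂'
      hε₁.le hζ (fun _ => hR hi) hWi hζW hWd (fun _ _ => pairDensity_nonneg _ _ _)
      (fun _ _ => pairDensity_le_one _ _ _)
      (fun _ j => j = i ∨ ¬ CutRegular G ε₁ i j) ?_ (fun _ => ?_)).mono ?_)
    · intro _ j _ hb
      push Not at hb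
      exact ⟨hb.2, le_rfl⟩
    · exact (sum_filter_eq_irregularWeight _ _ _ _).trans_le (hRw i hi)
    · simp only [prod_const, card_univ, Fintype.card_fin]
      have := mul_le_mul_of_nonneg_right herr hN0.le
      linarith
  have hdense : ∀ i ∈ R, ∑ j ∈ P.parts with 1 - δ < pairDensity G i j, (#j : ℝ) ≤ h * N := by
    intro i hi
    have h1 : (1 - γ / 2) * ∑ j ∈ P.parts with 1 - δ < pairDensity G i j, (#j : ℝ) ≤
        ∑ j ∈ P.parts, #j * pairDensity G i j ^ k := by
      rw [mul_sum]
      refine (sum_le_sum fun j hj => ?_).trans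
        (sum_le_sum_of_subset_of_nonneg (filter_subset (fun j => 1 - δ < pairDensity G i j) _)
          fun j _ _ => mul_nonneg (by positivity) (pow_nonneg (pairDensity_nonneg _ _ _) k))
      have hd := (mem_filter.1 hj).2
      have h2 : 1 - γ / 2 ≤ (1 - δ) ^ k := by
        have := one_add_mul_le_pow (show (-2 : ℝ) ≤ -δ by linarith) k
        have e : 1 + (k : ℝ) * -δ = 1 - γ / 2 := by rw [← hδ']; ring
        rw [e] at this
        simpa [sub_eq_add_neg] using this
      have h3 : (1 - δ) ^ k ≤ pairDensity G i j ^ k :=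
        pow_le_pow_left₀ (by linarith) hd.le k
      rw [mul_comm]
      gcongr
      exact h2.trans h3
    have h4 := hpow i hi
    have h5 : (h - γ / 2) * N ≤ (1 - γ / 2) * (h * N) := by
      have : 0 ≤ γ / 2 * (1 - h) * N := by
        have := sub_nonneg.2 hh1
        positivity
      linarith
    exact le_of_mul_le_mul_left (by linarith) (show (0 : ℝ) < 1 - γ / 2 by linarith)
  have hsparse : ∀ i ∈ R, ∑ j ∈ R with
      (j = i ∨ ¬ CutRegular G ε₁ i j) ∨ 1 - δ < pairDensity G i j, (#j : ℝ) ≤ (h + θ) * N := by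
    intro i hi
    calc ∑ j ∈ R with (j = i ∨ ¬ CutRegular G ε₁ i j) ∨ 1 - δ < pairDensity G i j, (#j : ℝ)
        ≤ ∑ j ∈ P.parts with (j = i ∨ ¬ CutRegular G ε₁ i j) ∨ 1 - δ < pairDensity G i j,
            (#j : ℝ) :=
          sum_le_sum_of_subset_of_nonneg (filter_subset_filter _ hR) fun _ _ _ => by positivity
      _ ≤ ∑ j ∈ P.parts with j = i ∨ ¬ CutRegular G ε₁ i j, (#j : ℝ) +
            ∑ j ∈ P.parts with 1 - δ < pairDensity G i j, (#j : ℝ) := by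
          rw [filter_or, ← sum_union_inter]
          have : (0 : ℝ) ≤ ∑ j ∈ (P.parts.filter fun j => j = i ∨ ¬ CutRegular G ε₁ i j) ∩
              P.parts.filter fun j => 1 - δ < pairDensity G i j, (#j : ℝ) :=
            sum_nonneg fun _ _ => by positivity
          linarith
      _ ≤ θ * N + h * N := by
          refine add_le_add ?_ (hdense i hi)
          exact (sum_filter_eq_irregularWeight _ _ _ _).trans_le (hRw i hi)
      _ = (h + θ) * N := by ring
  have hRlarge : k * ((h + θ) * N) < ∑ j ∈ R, (#j : ℝ) + (h + θ) * N := by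
    have h1 := nat_mul_half_pow_le k
    rw [← hh] at h1
    have h2 : k * ((h + θ) * N) < (1 / 2 + h) * N := by
      rw [← mul_assoc]
      exact mul_lt_mul_of_pos_right (by linarith) hN0
    linarith
  obtain ⟨f, hfR, hf⟩ := exists_tuple_of_sparse_bad (μ := fun j : Finset V => (#j : ℝ))
    (fun _ => by positivity)
    (fun i j => (j = i ∨ ¬ CutRegular G ε₁ i j) ∨ 1 - δ < pairDensity G i j)
    (t := (h + θ) * N) (by positivity) k R hsparse hRlarge
  have hbook : ∑ j ∈ P.parts, #j * ∏ a, (1 - pairDensity G (f a) j) < (h - γ / 2) * N := by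
    by_contra hge
    push Not at hge
    refine hblue ((hasBook_of_denseRegularTuple (k := k) (G := Gᶜ) P (i := f) (W := f) (ζ := 1)
      (θ := θ)
      (τ := fun a j => 1 - pairDensity G (f a) j) hε₁ hδ hδ1 (show γ / 4 ≤ 1 by linarith) hε₁'
      hε₁.le one_pos (fun a => hR (hfR a)) (fun _ => subset_rfl) (fun a => by simp) ?_
      (fun a j => by linarith [pairDensity_le_one G (f a) j])
      (fun a j => by linarith [pairDensity_nonneg G (f a) j])
      (fun a j => j = f a ∨ ¬ CutRegular G ε₁ (f a) j) ?_ (fun a => ?_)).mono ?_)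
    · intro a b hab
      have := hf a b hab
      push Not at this
      obtain ⟨⟨h1, h2⟩, h3⟩ := this
      have hd : Disjoint (f a) (f b) := P.disjoint (hR (hfR a)) (hR (hfR b)) (Ne.symm h1)
      have ha' := P.nonempty_of_mem_parts (hR (hfR a))
      have hb' := P.nonempty_of_mem_parts (hR (hfR b))
      refine ⟨h2.compl hd ha' hb', ?_⟩
      rw [pairDensity_compl G hd ha' hb']
      linarith
    · intro a j hj hb
      push Not at hb
      obtain ⟨h1, h2⟩ := hb
      have hd : Disjoint (f a) j := P.disjoint (hR (hfR a)) hj (Ne.symm h1)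
      have ha' := P.nonempty_of_mem_parts (hR (hfR a))
      have hb' := P.nonempty_of_mem_parts hj
      exact ⟨h2.compl hd ha' hb', (pairDensity_compl G hd ha' hb').ge⟩
    · exact (sum_filter_eq_irregularWeight _ _ _ _).trans_le (hRw (f a) (hfR a))
    · have := mul_le_mul_of_nonneg_right herr1 hN0.le
      linarith
  have hlower : 2 * h * N ≤ ∑ j ∈ P.parts, #j * ∏ a, (1 - pairDensity G (f a) j) +
      (∑ a, ∑ j ∈ P.parts, #j * pairDensity G (f a) j ^ k) / k := by
    rw [sum_comm, sum_div, ← sum_add_distrib, ← hcard, mul_sum]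
    refine sum_le_sum fun j _ => ?_
    rw [← mul_sum, mul_div_assoc, ← mul_add, mul_comm]
    gcongr
    exact two_mul_half_pow_le_prod_one_sub_add hk _ (fun _ => pairDensity_nonneg _ _ _)
      fun _ => pairDensity_le_one _ _ _
  have hupper : (∑ a, ∑ j ∈ P.parts, #j * pairDensity G (f a) j ^ k) / k ≤ (h - γ / 2) * N := by
    rw [div_le_iff₀ hk0]
    calc _ ≤ ∑ a : Fin k, (h - γ / 2) * N := sum_le_sum fun a _ => (hpow _ (hfR a)).le
      _ = _ := by simp [mul_comm]
  have : 0 < γ * N := by positivity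
  linarith

/-- Every large graph or its complement contains a `k`-clique with at least
`(2 ^ (-k) - γ) |V|` common neighbours. -/
theorem exists_hasBook_or_hasBook_compl {k : ℕ} (hk : 1 ≤ k) {γ : ℝ} (hγ : 0 < γ) (hγ1 : γ ≤ 1) :
    ∃ N₀ : ℕ, ∀ (V : Type u) [Fintype V] (G : SimpleGraph V), N₀ ≤ Fintype.card V →
      HasBook k G (((1 / 2) ^ k - γ) * Fintype.card V) ∨
      HasBook k Gᶜ (((1 / 2) ^ k - γ) * Fintype.card V) := by
  classical
  have hk0 : (0 : ℝ) < k := by exact_mod_cast hk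
  -- The regularity `ε₁` between the parts is chosen after `ζ`, hence after the regularity `ε₂` inside
  -- them: it has to control subsets of relative size `ζ`.
  obtain ⟨ε₂, hε₂, hε₂'⟩ : ∃ ε₂ : ℝ, 0 < ε₂ ∧
      2 * (k ^ 2 * ε₂) ≤ (1 / 2) ^ (k ^ 2) * (γ / 4) :=
    ⟨(1 / 2) ^ (k ^ 2) * (γ / 4) / (2 * k ^ 2), by positivity, le_of_eq (by field_simp)⟩
  obtain ⟨ζ₀, hζ₀, L, hL⟩ := exists_denseRegularTuple_subset.{u} k hε₂
  obtain ⟨ζ, hζ, hζ1, hζζ₀⟩ : ∃ ζ : ℝ, 0 < ζ ∧ ζ ≤ 1 ∧ ζ ≤ ζ₀ :=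
    ⟨min 1 ζ₀, lt_min one_pos hζ₀, min_le_left _ _, min_le_right _ _⟩
  obtain ⟨δ, hδ, hδ'⟩ : ∃ δ : ℝ, 0 < δ ∧ k * δ = γ / 2 :=
    ⟨γ / 2 / k, by positivity, by field_simp⟩
  have hh0 : (0 : ℝ) < (1 / 2) ^ k := by positivity
  have hh1 : ((1 : ℝ) / 2) ^ k ≤ 1 := pow_le_one₀ (by norm_num) (by norm_num)
  obtain ⟨θ, hθ, hθ'⟩ : ∃ θ : ℝ, 0 < θ ∧ k * θ = γ * (1 / 2) ^ k / 8 :=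
    ⟨γ * (1 / 2) ^ k / 8 / k, by positivity, by field_simp⟩
  obtain ⟨ε₁, hε₁, hε₁', hε₁''⟩ : ∃ ε₁ : ℝ, 0 < ε₁ ∧
      2 * (k ^ 2 * ε₁) ≤ δ ^ (k ^ 2) * (γ / 4) ∧ k * (ε₁ / ζ) ≤ γ / 8 := by
    refine ⟨min (δ ^ (k ^ 2) * (γ / 4) / (2 * k ^ 2)) (γ / 8 * ζ / k),
      lt_min (by positivity) (by positivity), ?_, ?_⟩
    · calc _ ≤ 2 * (k ^ 2 * (δ ^ (k ^ 2) * (γ / 4) / (2 * k ^ 2))) := by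
            gcongr; exact min_le_left _ _
        _ = _ := by field_simp
    · calc _ ≤ k * (γ / 8 * ζ / k / ζ) := by gcongr; exact min_le_right _ _
        _ = _ := by field_simp
  obtain ⟨M, N₁, hM, hreg⟩ := exists_regular_partition.{u} hε₁ hθ
  refine ⟨max (N₁ + 1) (M * L), fun V _ G hV => ?_⟩
  have hV1 : N₁ + 1 ≤ Fintype.card V := (le_max_left _ _).trans hV
  have hV2 : M * L ≤ Fintype.card V := (le_max_right _ _).trans hV
  have : Nonempty V := Fintype.card_pos_iff.1 (by omega)
  obtain ⟨P, hPM, hPw⟩ := hreg V G (by omega)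
  set N : ℝ := (Fintype.card V : ℝ) with hN
  have hN0 : 0 < N := by rw [hN]; exact_mod_cast Fintype.card_pos
  have hcard : ∑ j ∈ P.parts, (#j : ℝ) = N := by
    have := P.sum_card_parts
    rw [card_univ] at this
    rw [hN]
    exact_mod_cast this
  have hθγ : k * θ ≤ γ / 8 := by
    have := mul_le_mul_of_nonneg_left hh1 hγ.le
    linarith
  have hθh : k * θ < (1 / 2) ^ k := by
    have := mul_le_mul_of_nonneg_right hγ1 hh0.le
    linarith
  set S := P.parts.filter fun i => ¬ θ * N < irregularWeight P.parts G ε₁ i with hS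
  have hSP : S ⊆ P.parts := filter_subset _ _
  have hSw := sum_filter_add_sum_filter_not P.parts
    (fun i => θ * N < irregularWeight P.parts G ε₁ i) fun i => (#i : ℝ)
  have hSirr : ∀ i ∈ S, irregularWeight P.parts G ε₁ i ≤ θ * N := fun i hi =>
    not_lt.1 (mem_filter.1 hi).2
  have htuple : ∀ i ∈ S, ∃ W : Fin k → Finset V, (∀ a, W a ⊆ i) ∧ (∀ a, ζ * #i ≤ #(W a)) ∧
      (DenseRegularTuple G ε₂ (1 / 2) W ∨ DenseRegularTuple Gᶜ ε₂ (1 / 2) W) := by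
    intro i hi
    have hLi : L ≤ #i := Nat.le_of_mul_le_mul_left (hV2.trans (hPM i (hSP hi))) hM
    obtain ⟨W, h1, h2, h3⟩ := hL V G i hLi
    exact ⟨W, h1, fun a => le_trans (by gcongr) (h2 a), h3⟩
  set p : Finset V → Prop := fun i => ∃ W : Fin k → Finset V, (∀ a, W a ⊆ i) ∧
    (∀ a, ζ * #i ≤ #(W a)) ∧ DenseRegularTuple G ε₂ (1 / 2) W with hp
  have hsplit := sum_filter_add_sum_filter_not S p fun i => (#i : ℝ)
  have hθN : 0 < θ * N := by positivity
  rcases le_total (N / 2 - θ * N) (∑ i ∈ S with p i, (#i : ℝ)) with h | h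
  · exact hasBook_or_hasBook_compl_of_parts hk P hγ hγ1 hε₂ hε₂' hζ hζ1 hδ hδ' hθ hθγ hθh hε₁
      hε₁' hε₁'' ((filter_subset _ _).trans hSP)
      (fun i hi => hSirr i (filter_subset _ _ hi)) h fun i hi => (mem_filter.1 hi).2
  · have key := hasBook_or_hasBook_compl_of_parts (G := Gᶜ) hk P hγ hγ1 hε₂ hε₂' hζ hζ1 hδ hδ'
      hθ hθγ hθh hε₁ hε₁' hε₁'' (R := S.filter fun i => ¬ p i)
      ((filter_subset _ _).trans hSP) (fun i hi => ?_) (by linarith) (fun i hi => ?_)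
    · rw [compl_compl] at key
      exact key.symm
    · have hiS := filter_subset _ _ hi
      refine le_trans ?_ (hSirr i hiS)
      refine sum_le_sum_of_subset_of_nonneg (fun j hj => ?_) fun _ _ _ => by positivity
      obtain ⟨hjP, hj⟩ := mem_filter.1 hj
      refine mem_filter.2 ⟨hjP, ?_⟩
      by_contra hn
      push Not at hn
      refine hj.elim hn.1 fun h' => h' (hn.2.compl ?_ (P.nonempty_of_mem_parts (hSP hiS))
        (P.nonempty_of_mem_parts hjP))
      exact P.disjoint (hSP hiS) hjP (Ne.symm hn.1)
    · obtain ⟨hiS, hnp⟩ := mem_filter.1 hi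
      obtain ⟨W, h1, h2, h3⟩ := htuple i hiS
      exact ⟨W, h1, h2, h3.resolve_left fun h' => hnp ⟨W, h1, h2, h'⟩⟩

/-! ### The upper bound -/

theorem HasBook.isContained {V : Type*} [Fintype V] {k n : ℕ} {G : SimpleGraph V}
    (h : HasBook k G n) : (bookGraph k n).IsContained G := by
  classical
  obtain ⟨q, hq, hn⟩ := h
  have hn' : n ≤ #(univ.filter fun v => ∀ a, G.Adj (q a) v) := by exact_mod_cast hn
  obtain ⟨T, hT, hTn⟩ := exists_subset_card_eq hn'
  let e : Fin n ≃ T := (T.equivFinOfCardEq hTn).symm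
  have hp : ∀ a j, G.Adj (q a) (e j : V) := fun a j => (mem_filter.1 (hT (e j).2)).2 a
  have hqq : ∀ a b, a ≠ b → G.Adj (q a) (q b) := fun a b hab =>
    hab.lt_or_gt.elim (hq a b) fun h => (hq b a h).symm
  refine ⟨⟨⟨Sum.elim q fun j => e j, ?_⟩, ?_⟩⟩
  · rintro (a | i) (b | j) ⟨hne, hl⟩
    · exact hqq a b fun h => hne (by rw [h])
    · exact hp a j
    · exact (hp b i).symm
    · simp at hl
  · rintro (a | i) (b | j) hab
    · by_contra hne
      exact (hqq a b fun h => hne (by rw [h])).ne hab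
    · exact absurd hab (hp a j).ne
    · exact absurd hab (hp b i).ne'
    · have : e i = e j := Subtype.ext hab
      rw [e.injective this]

theorem labelGraph_one_eq_compl {V : Type*} (C : SimpleGraph.TopEdgeLabeling V (Fin 2)) :
    C.labelGraph 1 = (C.labelGraph 0)ᶜ := by
  ext x y
  rw [SimpleGraph.compl_adj, SimpleGraph.TopEdgeLabeling.labelGraph_adj,
    SimpleGraph.TopEdgeLabeling.labelGraph_adj]
  constructor
  · rintro ⟨h, h1⟩
    exact ⟨h, fun ⟨_, h0⟩ => by rw [h1] at h0; exact absurd h0 (by decide)⟩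
  · rintro ⟨h, h1⟩
    refine ⟨h, ?_⟩
    have h2 : C.get x y h ≠ 0 := fun h0 => h1 ⟨h, h0⟩
    omega

/-- The bound `2 ^ k n + ε n` from above, phrased for some `N` since `RamseyProperty` is not assumed
to be monotone in `N`. -/
theorem exists_ramseyProperty_bookGraph {k : ℕ} (hk : 1 ≤ k) {ε : ℝ} (hε : 0 < ε) :
    ∃ n₀ : ℕ, ∀ n ≥ n₀, ∃ N : ℕ, (N : ℝ) ≤ (2 ^ k + ε) * n ∧
      RamseyProperty (bookGraph k n) (bookGraph k n) N := by
  set γ : ℝ := ε / 2 / (2 ^ k * (2 ^ k + ε / 2)) with hγ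
  have h2 : (1 : ℝ) ≤ 2 ^ k := one_le_pow₀ (by norm_num)
  have hγ0 : 0 < γ := by positivity
  have hγ1 : γ ≤ 1 := by
    rw [hγ, div_le_one (by positivity)]
    nlinarith
  obtain ⟨N₀, hN₀⟩ := exists_hasBook_or_hasBook_compl.{0} hk hγ0 hγ1
  refine ⟨max N₀ ⌈2 / ε⌉₊, fun n hn => ?_⟩
  have hn1 : N₀ ≤ n := (le_max_left _ _).trans hn
  have hn2 : 2 / ε ≤ n := (Nat.le_ceil _).trans (by exact_mod_cast (le_max_right _ _).trans hn)
  rw [div_le_iff₀ hε] at hn2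
  have hx : 0 ≤ (2 ^ k + ε) * (n : ℝ) := by positivity
  set N := ⌊(2 ^ k + ε) * (n : ℝ)⌋₊ with hN
  have hNle : (N : ℝ) ≤ (2 ^ k + ε) * n := Nat.floor_le hx
  have hNgt : (2 ^ k + ε) * (n : ℝ) < N + 1 := Nat.lt_floor_add_one _
  have hNge : (2 ^ k + ε / 2) * (n : ℝ) ≤ N := by linarith
  have hnN : n ≤ N := by
    have : (n : ℝ) ≤ N := by
      have := mul_le_mul_of_nonneg_right h2 (Nat.cast_nonneg (α := ℝ) n)
      have : 0 ≤ ε / 2 * (n : ℝ) := by positivity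
      linarith
    exact_mod_cast this
  have hpages : (n : ℝ) ≤ ((1 / 2) ^ k - γ) * N := by
    have e : ((1 / 2) ^ k - γ) * (2 ^ k + ε / 2) = 1 := by
      rw [hγ, one_div_pow]
      field_simp
      ring
    have hpos : 0 ≤ (1 / 2) ^ k - γ := by
      by_contra hneg
      push Not at hneg
      have := mul_neg_of_neg_of_pos hneg (show (0 : ℝ) < 2 ^ k + ε / 2 by positivity)
      linarith
    calc (n : ℝ) = ((1 / 2) ^ k - γ) * ((2 ^ k + ε / 2) * n) := by rw [← mul_assoc, e, one_mul]
      _ ≤ _ := by gcongr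
  refine ⟨N, hNle, fun C => ?_⟩
  rw [labelGraph_one_eq_compl]
  have h := hN₀ (Fin N) (C.labelGraph 0) (by simpa using hn1.trans hnN)
  rw [Fintype.card_fin] at h
  exact h.imp (fun h => (h.mono hpages).isContained) fun h => (h.mono hpages).isContained

/-! ### The lower bound -/

/-- Prescribing the value of a two-colouring at `m` points leaves at most a proportion `2 ^ (-m)` of
all colourings. -/
theorem card_pi_fixed_mul_pow_le {E : Type*} [Fintype E] [DecidableEq E] {ι : Type*} [Fintype ι]
    (f : ι → E) (hf : Function.Injective f) (c : Fin 2) :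
    #(univ.filter fun C : E → Fin 2 => ∀ i, C (f i) = c) * 2 ^ Fintype.card ι ≤
      2 ^ Fintype.card E := by
  set F : Finset E := univ.image f with hF
  have hFcard : #F = Fintype.card ι := by rw [hF, card_image_of_injective _ hf, card_univ]
  have hsub : (univ.filter fun C : E → Fin 2 => ∀ i, C (f i) = c) ⊆
      Fintype.piFinset fun e => if e ∈ F then {c} else univ := by
    intro C hC
    rw [Fintype.mem_piFinset]
    intro e
    split_ifs with he
    · obtain ⟨i, -, rfl⟩ := mem_image.1 he
      simpa using (mem_filter.1 hC).2 i
    · simp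
  have hpow : ∏ e : E, (if e ∈ F then 2 else 1) = 2 ^ Fintype.card ι := by
    rw [prod_ite_mem, univ_inter, prod_const, hFcard]
  calc _ ≤ (∏ e : E, (if e ∈ F then 1 else 2)) * 2 ^ Fintype.card ι := by
        refine Nat.mul_le_mul_right _ ((card_le_card hsub).trans (le_of_eq ?_))
        rw [Fintype.card_piFinset]
        exact prod_congr rfl fun e _ => by split_ifs <;> simp
    _ = ∏ e : E, 2 := by
        rw [← hpow, ← prod_mul_distrib]
        exact prod_congr rfl fun e _ => by split_ifs <;> simp
    _ = _ := by simp

/-- A first moment bound: in a random colouring the expected number of monochromatic placements of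
`k` spine vertices and `s` pages (ignoring the edges inside the spine) is at most
`2 N ^ (k + s) / 2 ^ (k s)`, whereas a book with `n` pages alone produces
`n (n - 1) ⋯ (n - s + 1)` of them. -/
theorem not_ramseyProperty_bookGraph {k n N s : ℕ}
    (h : 2 * N ^ (k + s) < n.descFactorial s * 2 ^ (k * s)) :
    ¬ RamseyProperty (bookGraph k n) (bookGraph k n) N := by
  classical
  intro hR
  let E := (⊤ : SimpleGraph (Fin N)).edgeSet
  let Ω := E → Fin 2
  let r : Ω → Fin 2 × (Fin k ⊕ Fin s ↪ Fin N) → Prop := fun C p =>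
    ∀ ij : Fin k × Fin s, ∃ hne : p.2 (Sum.inl ij.1) ≠ p.2 (Sum.inr ij.2),
      C ⟨s(p.2 (Sum.inl ij.1), p.2 (Sum.inr ij.2)), hne⟩ = p.1
  have habove : ∀ C ∈ (univ : Finset Ω), n.descFactorial s ≤ #(bipartiteAbove r univ C) := by
    intro C _
    obtain ⟨c, ⟨φ⟩⟩ : ∃ c, (bookGraph k n).IsContained
        (SimpleGraph.EdgeLabeling.labelGraph (G := (⊤ : SimpleGraph (Fin N))) C c) :=
      (hR C).elim (fun h => ⟨0, h⟩) fun h => ⟨1, h⟩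
    let g : (Fin s ↪ Fin n) → Fin 2 × (Fin k ⊕ Fin s ↪ Fin N) := fun σ =>
      (c, (Function.Embedding.sumMap (Function.Embedding.refl _) σ).trans
        ⟨φ.toHom, φ.injective'⟩)
    have hg : Function.Injective g := by
      intro σ τ hστ
      ext j
      have h1 : (g σ).2 (Sum.inr j) = (g τ).2 (Sum.inr j) := by rw [hστ]
      have h2 : (Sum.inr (σ j) : Fin k ⊕ Fin n) = Sum.inr (τ j) := φ.injective' h1
      rw [Sum.inr_injective h2]
    have hcard : Fintype.card (Fin s ↪ Fin n) = n.descFactorial s := by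
      simp [Fintype.card_embedding_eq]
    rw [← hcard, ← card_univ, ← card_image_of_injective _ hg]
    refine card_le_card fun p hp => ?_
    obtain ⟨σ, -, rfl⟩ := mem_image.1 hp
    refine mem_filter.2 ⟨mem_univ _, fun ij => ?_⟩
    have hadj : (bookGraph k n).Adj (Sum.inl ij.1) (Sum.inr (σ ij.2)) := ⟨by simp, by simp⟩
    exact (SimpleGraph.TopEdgeLabeling.labelGraph_adj (C := C) _ _).1 (φ.toHom.map_adj hadj)
  have hbelow : ∀ p ∈ (univ : Finset (Fin 2 × (Fin k ⊕ Fin s ↪ Fin N))),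
      #(bipartiteBelow r univ p) ≤ Fintype.card Ω / 2 ^ (k * s) := by
    rintro ⟨c, ψ⟩ -
    rw [Nat.le_div_iff_mul_le (by positivity)]
    have hne : ∀ ij : Fin k × Fin s, ψ (Sum.inl ij.1) ≠ ψ (Sum.inr ij.2) := fun ij h => by
      simpa using ψ.injective h
    let f : Fin k × Fin s → E := fun ij => ⟨s(ψ (Sum.inl ij.1), ψ (Sum.inr ij.2)), hne ij⟩
    have hf : Function.Injective f := by
      rintro ⟨i, j⟩ ⟨i', j'⟩ hij
      have h1 := congrArg Subtype.val hij
      simp only [f, Sym2.eq_iff] at h1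
      rcases h1 with ⟨h1, h2⟩ | ⟨h1, -⟩
      · rw [Sum.inl_injective (ψ.injective h1), Sum.inr_injective (ψ.injective h2)]
      · exact absurd (ψ.injective h1) (by simp)
    have h1 := card_pi_fixed_mul_pow_le f hf c
    have h2 : Fintype.card Ω = 2 ^ Fintype.card E := by simp [Ω]
    rw [h2]
    rw [Fintype.card_prod, Fintype.card_fin, Fintype.card_fin] at h1
    refine le_trans (Nat.mul_le_mul_right _ (card_le_card fun C hC => ?_)) h1
    refine mem_filter.2 ⟨mem_univ _, fun ij => ?_⟩
    obtain ⟨_, h3⟩ := (mem_filter.1 hC).2 ij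
    exact h3
  have hmain := card_mul_le_card_mul r habove hbelow
  have hΩ : 0 < Fintype.card Ω := Fintype.card_pos
  have hemb : Fintype.card (Fin 2 × (Fin k ⊕ Fin s ↪ Fin N)) ≤ 2 * N ^ (k + s) := by
    rw [Fintype.card_prod, Fintype.card_embedding_eq]
    simp only [Fintype.card_fin, Fintype.card_sum]
    exact Nat.mul_le_mul_left _ (Nat.descFactorial_le_pow _ _)
  rw [card_univ, card_univ] at hmain
  have : Fintype.card Ω * (n.descFactorial s * 2 ^ (k * s)) ≤
      Fintype.card Ω * (2 * N ^ (k + s)) := by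
    calc Fintype.card Ω * (n.descFactorial s * 2 ^ (k * s))
        = Fintype.card Ω * n.descFactorial s * 2 ^ (k * s) := by ring
      _ ≤ _ * (Fintype.card Ω / 2 ^ (k * s)) * 2 ^ (k * s) := Nat.mul_le_mul_right _ hmain
      _ = Fintype.card (Fin 2 × (Fin k ⊕ Fin s ↪ Fin N)) *
            (Fintype.card Ω / 2 ^ (k * s) * 2 ^ (k * s)) := by ring
      _ ≤ 2 * N ^ (k + s) * Fintype.card Ω :=
          Nat.mul_le_mul hemb (Nat.div_mul_le_self _ _)
      _ = _ := by ring
  exact absurd (Nat.le_of_mul_le_mul_left this hΩ) (not_le.2 h)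

/-- For `a < 2 ^ k` and large `n`, no `N ≤ a n` has the Ramsey property for books with `n` pages. All
such `N` are excluded at once, so that monotonicity in `N` is not needed. -/
theorem forall_not_ramseyProperty_bookGraph (k : ℕ) {a : ℝ} (ha : 0 ≤ a) (ha2 : a < 2 ^ k) :
    ∃ n₀ : ℕ, ∀ n ≥ n₀, ∀ N : ℕ, (N : ℝ) ≤ a * n →
      ¬ RamseyProperty (bookGraph k n) (bookGraph k n) N := by
  have h2 : (0 : ℝ) < 2 ^ k := by positivity
  obtain ⟨q, hq⟩ := exists_nat_gt (1 / (1 - a / 2 ^ k))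
  have h1 : 0 < 1 - a / 2 ^ k := by rw [sub_pos, div_lt_one h2]; exact ha2
  have hq0 : (0 : ℝ) < q := (by positivity : (0 : ℝ) < 1 / (1 - a / 2 ^ k)).trans hq
  have hqn : 0 < q := by exact_mod_cast hq0
  have hq' : 1 / (q : ℝ) < 1 - a / 2 ^ k := by
    rw [div_lt_comm₀ hq0 h1]; exact hq
  -- Placements with `s = n / q` pages are counted; `b` is a lower bound for `(n - s) / n`, and `q`
  -- is so large that `a < 2 ^ k * b` still holds.
  set b : ℝ := 1 - 1 / q with hb
  have hab : a / 2 ^ k < b := by linarith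
  have hb0 : 0 < b := lt_of_le_of_lt (by positivity) hab
  have hab' : a < 2 ^ k * b := by rw [div_lt_iff₀ h2] at hab; linarith
  set ρ : ℝ := a / (2 ^ k * b) with hρ
  have hρ0 : 0 ≤ ρ := by positivity
  have hρ1 : ρ < 1 := by rw [hρ, div_lt_one (by positivity)]; exact hab'
  have haρ : a = ρ * (2 ^ k * b) := by rw [hρ]; field_simp
  have hlim := (tendsto_pow_const_mul_const_pow_of_abs_lt_one k
    (r := ρ) (by rwa [abs_of_nonneg hρ0])).const_mul (2 * (a * (2 * q)) ^ k)
  rw [mul_zero] at hlim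
  obtain ⟨s₀, hs₀⟩ := eventually_atTop.1 (hlim.eventually_lt_const one_pos)
  refine ⟨q * (s₀ + 1), fun n hn N hN => ?_⟩
  set s := n / q with hs
  have hss : s₀ + 1 ≤ s := (Nat.le_div_iff_mul_le hqn).2 (by rw [mul_comm]; exact hn)
  have hsn : q * s ≤ n := Nat.mul_div_le n q
  have hns : n < q * (s + 1) := Nat.lt_mul_div_succ n hqn
  have hn0 : 0 < n := lt_of_lt_of_le (Nat.mul_pos hqn (Nat.succ_pos _)) hn
  have hn0' : (0 : ℝ) < n := by exact_mod_cast hn0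
  have hsn' : s ≤ n := Nat.div_le_self _ _
  have hs1 : (1 : ℝ) ≤ s := by exact_mod_cast (by omega : 1 ≤ s)
  have hn2qs : (n : ℝ) ≤ 2 * q * s := by
    have : (n : ℝ) ≤ q * (s + 1) := by exact_mod_cast hns.le
    have := mul_le_mul_of_nonneg_left hs1 hq0.le
    linarith
  have hdesc : (b * n) ^ s ≤ (n.descFactorial s : ℝ) := by
    have h3 : ((n + 1 - s : ℕ) : ℝ) ^ s ≤ (n.descFactorial s : ℝ) := by
      exact_mod_cast Nat.pow_sub_le_descFactorial n s
    refine le_trans (pow_le_pow_left₀ (by positivity) ?_ s) h3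
    rw [Nat.cast_sub (by omega)]
    push_cast
    have : (q : ℝ) * s ≤ n := by exact_mod_cast hsn
    have h4 : (s : ℝ) ≤ n / q := by rw [le_div_iff₀ hq0]; linarith
    have : b * n = n - n / q := by rw [hb]; ring
    linarith
  refine not_ramseyProperty_bookGraph (s := s) ?_
  have hreal : 2 * (N : ℝ) ^ (k + s) < n.descFactorial s * 2 ^ (k * s) := by
    have hbn : 0 < (2 ^ k * (b * n)) ^ s := by positivity
    have hlt := hs₀ s (by omega)
    calc 2 * (N : ℝ) ^ (k + s) ≤ 2 * (a * n) ^ (k + s) := by gcongr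
      _ = 2 * (a * n) ^ k * ρ ^ s * (2 ^ k * (b * n)) ^ s := by
          rw [pow_add]
          have : (a * n) ^ s = ρ ^ s * (2 ^ k * (b * n)) ^ s := by
            rw [← mul_pow]; congr 1; rw [haρ]; ring
          rw [this]; ring
      _ ≤ 2 * (a * (2 * q * s)) ^ k * ρ ^ s * (2 ^ k * (b * n)) ^ s := by gcongr
      _ = 2 * (a * (2 * q)) ^ k * (s ^ k * ρ ^ s) * (2 ^ k * (b * n)) ^ s := by ring
      _ < 1 * (2 ^ k * (b * n)) ^ s := by gcongr
      _ = (b * n) ^ s * 2 ^ (k * s) := by rw [one_mul, mul_pow, ← pow_mul]; ring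
      _ ≤ _ := by gcongr
  exact_mod_cast hreal

end BookRamsey

theorem theorem1p1 (k : ℕ) (hk : 1 ≤ k) :
    (fun n : ℕ => (diagonalRamseyNumber (bookGraph k n) : ℝ) - 2 ^ k * (n : ℝ))
      =o[atTop] (fun n : ℕ => (n : ℝ)) := by
  rw [isLittleO_iff]
  intro ε hε
  obtain ⟨n₁, hn₁⟩ := BookRamsey.exists_ramseyProperty_bookGraph hk hε
  have h2 : (0 : ℝ) < 2 ^ k := by positivity
  obtain ⟨n₂, hn₂⟩ := BookRamsey.forall_not_ramseyProperty_bookGraph k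
    (le_max_right (2 ^ k - ε) 0) (max_lt (by linarith) h2)
  filter_upwards [eventually_ge_atTop n₁, eventually_ge_atTop n₂] with n h₁ h₂
  obtain ⟨N, hN, hRN⟩ := hn₁ n h₁
  have hmem : RamseyProperty (bookGraph k n) (bookGraph k n)
      (diagonalRamseyNumber (bookGraph k n)) :=
    Nat.sInf_mem (s := {N : ℕ | RamseyProperty (bookGraph k n) (bookGraph k n) N}) ⟨N, hRN⟩
  have hle : (diagonalRamseyNumber (bookGraph k n) : ℝ) ≤ N := by
    exact_mod_cast
      Nat.sInf_le (s := {N : ℕ | RamseyProperty (bookGraph k n) (bookGraph k n) N}) hRN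
  have hge : (2 ^ k - ε) * (n : ℝ) ≤ diagonalRamseyNumber (bookGraph k n) := by
    by_contra hlt
    push Not at hlt
    exact hn₂ n h₂ _ (hlt.le.trans (by gcongr; exact le_max_left _ _)) hmem
  rw [Real.norm_eq_abs, Real.norm_eq_abs, abs_of_nonneg (Nat.cast_nonneg (α := ℝ) n), abs_le]
  constructor <;> linarith
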